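/- Let $F_q$ be a finite field with $q$ elements and $\overline{F_q}$ an algebraic closure of it. Call an $n\times n$ matrix over $F_q$ semisimple if it is diagonalizable over $\overline{F_q}$. Let $GL(n,q)$ be the group of invertible $n\times n$ matrices over $F_q$ and $Mat(n,q)$ the set of all $n\times n$ matrices over $F_q$, and choose elements uniformly at random. Then, for fixed $q$, the following infinite products converge and $$\lim_{n\to\infty}\frac{|\{\alpha\in GL(n,q):\ \alpha\text{ is semisimple}\}|}{|GL(n,q)|}=\prod_{\substack{r\ge 1\\ r\equiv 0,\pm 2\ (\mathrm{mod}\ 5)}}\frac{1-\frac{1}{q^{r-1}}}{1-\frac{1}{q^{r}}},$$ $$\lim_{n\to\infty}\frac{|\{\alpha\in Mat(n,q):\ \alpha\text{ is semisimple}\}|}{|Mat(n,q)|}=\prod_{\substack{r\ge 1\\ r\equiv 0,\pm 2\ (\mathrm{mod}\ 5)}}\Bigl(1-\frac{1}{q^{r-1}}\Bigr).$$ -/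

import Mathlib

namespace SemisimpleLimit

/-- A square matrix over a field `F` is semisimple if it is diagonalizable over the algebraic
closure of `F`. -/
def IsSemisimpleMatrix {F : Type*} [Field F] {n : ℕ} (A : Matrix (Fin n) (Fin n) F) : Prop :=
  ∃ (P : GL (Fin n) (AlgebraicClosure F)) (d : Fin n → AlgebraicClosure F),
    (P⁻¹).val * A.map (algebraMap F (AlgebraicClosure F)) * P.val = Matrix.diagonal d

/-- The proportion of semisimple elements in `GL(n, F)`, for `F` a finite field. -/
noncomputable def probGL (F : Type*) [Field F] (n : ℕ) : ℝ :=
  (Nat.card {g : GL (Fin n) F // IsSemisimpleMatrix g.val} : ℝ) / (Nat.card (GL (Fin n) F) : ℝ)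

/-- The proportion of semisimple elements in `Mat(n, F)`, for `F` a finite field. -/
noncomputable def probMat (F : Type*) [Field F] (n : ℕ) : ℝ :=
  (Nat.card {A : Matrix (Fin n) (Fin n) F // IsSemisimpleMatrix A} : ℝ) /
    (Nat.card (Matrix (Fin n) (Fin n) F) : ℝ)

/-- The positive integers congruent to `0` or `±2` modulo `5`. -/
def goodIndices : Set ℕ :=
  {r | 1 ≤ r ∧ ((r : ZMod 5) = 0 ∨ (r : ZMod 5) = 2 ∨ (r : ZMod 5) = -2)}

end SemisimpleLimit

/-!
A matrix over a finite field `F` with `q` elements is semisimple if and only if it is annihilated by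
a squarefree polynomial, that is, if and only if `F ^ n` with the matrix acting as `X` is isomorphic
to a module `∏ (F[X] / (φ)) ^ e φ`, where `φ` runs over the monic irreducible polynomials
(`exists_hasType`). So the similarity classes of semisimple matrices correspond to the finitely
supported exponent vectors `e` with `∑ e φ * deg φ = n`. The automorphism group of the module is
`∏ GL (e φ, q ^ deg φ)`, and counting linear isomorphisms onto the module shows that the class has
`|GL (n, q)| / ∏ |GL (e φ, q ^ deg φ)|` elements (`card_hasType_mul`). A semisimple matrix is
invertible exactly if `e X = 0`. Both proportions are thus sums, over the vectors of weight `n`, of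
the multiplicative function with local values `w φ j = 1 / |GL (j, q ^ deg φ)|`; for all matrices
the sum is multiplied by `|GL (n, q)| / q ^ (n ^ 2)`, which tends to Euler's product.

Such sums have limits. By unique factorization, exactly `q ^ m` exponent vectors have weight `m`. If
`w` is the convolution of a multiplicative function `h` with `q ^ (-weight)`, the sum of `w` over
the vectors of weight `n` is therefore the sum of `h` over all vectors of weight at most `n`
(`sum_level_eq_sum_sum_level`). When `h` is absolutely summable the limit is the Euler product of
the series `∑ j, h φ j` (`exists_tendsto_sum_level`). Here this series is
`(1 - y) ∑ 1 / |GL (j, 1 / y)|` with `y = q ^ (-deg φ)`, and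
`1 / |GL (j, 1 / y)| = y ^ (j ^ 2) / ((1 - y) ⋯ (1 - y ^ j))`, so that the sum is the sum side of
the first Rogers–Ramanujan identity.

That identity (`rogersRamanujan`) is proved by applying Bailey's lemma twice to the unit Bailey pair
and evaluating the resulting theta series with Jacobi's triple product. It makes the local factor
equal to `∏ n, 1 / ((1 - y ^ (5 n + 4)) (1 - y ^ (5 n + 6)))`. For fixed `n`, the product over `φ`
of these factors is a product of two values of the zeta function of `F[X]`, and exchanging the two
products turns the limit into `∏ n, 1 / ((1 - x ^ (5 n + 3)) (1 - x ^ (5 n + 5)))` with `x = 1 / q`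
(`hasProd_of_hasProd_local`). For `Mat (n, q)`, Euler's product cancels these denominators and
leaves the stated product. For `GL (n, q)`, the series at `φ = X` is replaced by `1 - x`, that is,
the limit is divided by the Rogers–Ramanujan sum at `x`, which contributes the numerators
(`hasProd_mat`, `hasProd_gl`).
-/

namespace SemisimpleLimit

open Filter Topology

/-! ### The first Rogers–Ramanujan identity -/

/-- The `q`-factorial `(x; x)_n = ∏_{i = 1}^{n} (1 - x ^ i)`. -/
noncomputable def qFac (x : ℝ) (n : ℕ) : ℝ := ∏ i ∈ Finset.range n, (1 - x ^ (i + 1))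

/-- The reciprocal `1 / (x; x)_m`, extended by `0` to negative `m`, so that the recurrence
`invQFac_sub_one` holds for every integer. -/
noncomputable def invQFac (x : ℝ) (m : ℤ) : ℝ := if m < 0 then 0 else (qFac x m.toNat)⁻¹

/-- Euler's product `(x; x)_∞`. -/
noncomputable def eulerProd (x : ℝ) : ℝ := ∏' i : ℕ, (1 - x ^ (i + 1))

lemma one_sub_pow_pos {x : ℝ} (h0 : 0 < x) (h1 : x < 1) (i : ℕ) : 0 < 1 - x ^ (i + 1) :=
  sub_pos.2 (pow_lt_one₀ h0.le h1 (Nat.succ_ne_zero i))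

lemma qFac_pos {x : ℝ} (h0 : 0 < x) (h1 : x < 1) (n : ℕ) : 0 < qFac x n :=
  Finset.prod_pos fun i _ => one_sub_pow_pos h0 h1 i

lemma qFac_succ (x : ℝ) (n : ℕ) : qFac x (n + 1) = qFac x n * (1 - x ^ (n + 1)) :=
  Finset.prod_range_succ _ _

lemma invQFac_of_neg (x : ℝ) {m : ℤ} (hm : m < 0) : invQFac x m = 0 := if_pos hm

lemma invQFac_natCast (x : ℝ) (n : ℕ) : invQFac x n = (qFac x n)⁻¹ := by
  simp [invQFac]

lemma invQFac_zero (x : ℝ) : invQFac x 0 = 1 := by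
  simp [invQFac, qFac]

lemma invQFac_nonneg {x : ℝ} (h0 : 0 < x) (h1 : x < 1) (m : ℤ) : 0 ≤ invQFac x m := by
  unfold invQFac
  split_ifs
  · exact le_rfl
  · exact inv_nonneg.2 (qFac_pos h0 h1 _).le

lemma invQFac_sub_one {x : ℝ} (h0 : 0 < x) (h1 : x < 1) (m : ℤ) :
    invQFac x (m - 1) = (1 - x ^ m) * invQFac x m := by
  rcases lt_trichotomy m 0 with hm | rfl | hm
  · rw [invQFac_of_neg x hm, invQFac_of_neg x (by omega), mul_zero]
  · rw [invQFac_of_neg x (by omega)]; simp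
  · obtain ⟨n, rfl⟩ : ∃ n : ℕ, m = n + 1 := ⟨(m - 1).toNat, by omega⟩
    have e : ((n : ℤ) + 1) = ((n + 1 : ℕ) : ℤ) := by push_cast; ring
    rw [add_sub_cancel_right, e, invQFac_natCast, invQFac_natCast, qFac_succ, zpow_natCast]
    have := (qFac_pos h0 h1 n).ne'
    have := (one_sub_pow_pos h0 h1 n).ne'
    field_simp

/-- The `q`-Chu–Vandermonde summation, in the form needed for Bailey's lemma. -/
lemma qVandermonde {x : ℝ} (h0 : 0 < x) (h1 : x < 1) (m : ℕ) (c : ℤ) :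
    ∑ k ∈ Finset.range (m + 1), x ^ ((k : ℤ) * (k + c)) * invQFac x k * invQFac x (k + c) *
      invQFac x (m - k) = invQFac x m * invQFac x (m + c) := by
  induction m generalizing c with
  | zero => simp [invQFac_zero]
  | succ m ih =>
    have hx := h0.ne'
    have hne := (one_sub_pow_pos h0 h1 m).ne'
    have hR : (1 - x ^ (m + 1)) * (invQFac x (m + 1 : ℕ) * invQFac x ((m + 1 : ℕ) + c)) =
        invQFac x m * invQFac x (m + (c + 1)) := by
      have := invQFac_sub_one h0 h1 ((m + 1 : ℕ) : ℤ)
      rw [zpow_natCast] at this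
      rw [← mul_assoc, ← this]
      congr 2 <;> push_cast <;> ring
    apply mul_left_cancel₀ hne
    rw [hR, ← ih (c + 1), Finset.mul_sum]
    -- split `1 - x ^ (m + 1)` as `(1 - x ^ k) + x ^ k * (1 - x ^ (m + 1 - k))`
    have split : ∀ k ∈ Finset.range (m + 1 + 1), (1 - x ^ (m + 1)) *
        (x ^ ((k : ℤ) * (k + c)) * invQFac x k * invQFac x (k + c) *
          invQFac x ((m + 1 : ℕ) - k)) =
        x ^ ((k : ℤ) * (k + c)) * invQFac x (k - 1) * invQFac x (k + c) *
          invQFac x ((m + 1 : ℕ) - k) +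
        x ^ ((k : ℤ) * (k + c) + k) * invQFac x k * invQFac x (k + c) *
          invQFac x (m - k) := by
      intro k _
      have e1 := invQFac_sub_one h0 h1 (k : ℤ)
      have e2 := invQFac_sub_one h0 h1 (((m + 1 : ℕ) : ℤ) - k)
      rw [show ((m + 1 : ℕ) : ℤ) - k - 1 = m - k by push_cast; ring] at e2
      rw [e1, e2, zpow_add₀ hx, zpow_sub₀ hx, zpow_natCast, zpow_natCast]
      have := pow_ne_zero k hx
      field_simp
      ring
    rw [Finset.sum_congr rfl split, Finset.sum_add_distrib, Finset.sum_range_succ' _ (m + 1),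
      Finset.sum_range_succ (fun k : ℕ => x ^ ((k : ℤ) * (k + c) + k) * invQFac x k *
        invQFac x (k + c) * invQFac x (m - k)) (m + 1)]
    rw [invQFac_of_neg x (m := ((0 : ℕ) : ℤ) - 1) (by simp),
      invQFac_of_neg x (m := (m : ℤ) - ((m + 1 : ℕ) : ℤ)) (by push_cast; omega)]
    simp only [mul_zero, zero_mul, add_zero]
    rw [← Finset.sum_add_distrib]
    refine Finset.sum_congr rfl fun k _ => ?_
    have e1 := invQFac_sub_one h0 h1 ((k : ℤ) + c + 1)
    rw [add_sub_cancel_right] at e1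
    rw [e1, show ((k + 1 : ℕ) : ℤ) - 1 = k by push_cast; ring,
      show ((k + 1 : ℕ) : ℤ) + c = k + c + 1 by push_cast; ring,
      show ((m + 1 : ℕ) : ℤ) - (k + 1 : ℕ) = m - k by push_cast; ring,
      show (k : ℤ) + (c + 1) = k + c + 1 by ring,
      show ((k + 1 : ℕ) : ℤ) * (k + c + 1) = k * (k + c) + k + (k + c + 1) by push_cast; ring,
      show (k : ℤ) * (k + c + 1) = k * (k + c) + k by ring,
      zpow_add₀ hx (k * (k + c) + k : ℤ) (k + c + 1)]
    ring

/-- The coefficient identity behind Bailey's lemma. -/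
lemma sum_invQFac_mul {x : ℝ} (h0 : 0 < x) (h1 : x < 1) (N : ℕ) (t : ℤ) :
    ∑ s ∈ Finset.range (N + 1), x ^ (s ^ 2) * invQFac x (N - s) *
      (invQFac x (s - t) * invQFac x (s + t)) =
    x ^ (t ^ 2) * (invQFac x (N - t) * invQFac x (N + t)) := by
  wlog ht : 0 ≤ t generalizing t
  · have := this (-t) (by omega)
    simp only [sub_neg_eq_add, neg_sq, ← sub_eq_add_neg] at this
    rw [mul_comm (invQFac x (N - t)), ← this]
    refine Finset.sum_congr rfl fun s _ => by ring
  obtain ⟨u, rfl⟩ := Int.eq_ofNat_of_zero_le ht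
  by_cases hu : N < u
  · rw [invQFac_of_neg x (m := (N : ℤ) - u) (by omega), zero_mul, mul_zero]
    refine Finset.sum_eq_zero fun s hs => ?_
    rw [Finset.mem_range] at hs
    rw [invQFac_of_neg x (m := (s : ℤ) - u) (by omega), zero_mul, mul_zero]
  obtain ⟨m, rfl⟩ := Nat.exists_eq_add_of_le (not_lt.1 hu)
  have hV := qVandermonde h0 h1 m (2 * u)
  rw [show u + m + 1 = u + (m + 1) by ring, Finset.sum_range_add, Finset.sum_eq_zero, zero_add,
    show ((u + m : ℕ) : ℤ) - u = m by push_cast; ring,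
    show ((u + m : ℕ) : ℤ) + u = m + 2 * u by push_cast; ring, ← hV, Finset.mul_sum]
  · refine Finset.sum_congr rfl fun k _ => ?_
    rw [show ((u + k : ℕ) : ℤ) - u = k by push_cast; ring,
      show ((u + k : ℕ) : ℤ) + u = k + 2 * u by push_cast; ring,
      show ((u + m : ℕ) : ℤ) - (u + k : ℕ) = m - k by push_cast; ring,
      ← zpow_natCast, show (((u + k) ^ 2 : ℕ) : ℤ) = (u : ℤ) ^ 2 + k * (k + 2 * u) by
        push_cast; ring, zpow_add₀ h0.ne']
    ring
  · intro s hs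
    rw [Finset.mem_range] at hs
    rw [invQFac_of_neg x (m := (s : ℤ) - u) (by omega), zero_mul, mul_zero]

lemma HasSum.of_eq_of_eq {ι : Type*} {f g : ι → ℝ} {a b : ℝ} (h : HasSum f a)
    (hf : ∀ i, g i = f i) (ha : b = a) : HasSum g b := by
  rwa [ha, show g = f from funext hf]

/-- Bailey's lemma: multiplying the `α`-sequence by `x ^ (t ^ 2)` turns the `β`-sequence `b` into
`∑ s ≤ N, x ^ (s ^ 2) / (x; x)_{N - s} * b s`. -/
lemma bailey {x : ℝ} (h0 : 0 < x) (h1 : x < 1) {α : ℤ → ℝ} {b : ℕ → ℝ}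
    (h : ∀ s : ℕ, HasSum (fun t : ℤ => α t * (invQFac x (s - t) * invQFac x (s + t))) (b s))
    (N : ℕ) :
    HasSum (fun t : ℤ => x ^ (t ^ 2) * α t * (invQFac x (N - t) * invQFac x (N + t)))
      (∑ s ∈ Finset.range (N + 1), x ^ (s ^ 2) * invQFac x (N - s) * b s) := by
  refine HasSum.of_eq_of_eq (hasSum_sum (s := Finset.range (N + 1))
    fun s _ => (h s).mul_left (x ^ (s ^ 2) * invQFac x (N - s))) (fun t => ?_) rfl
  rw [mul_comm (x ^ (t ^ 2)), mul_assoc, ← sum_invQFac_mul h0 h1, Finset.mul_sum]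
  exact Finset.sum_congr rfl fun s _ => by ring

/-- The integer `t (t - 1) / 2`. -/
def triangle (t : ℤ) : ℤ := t * (t - 1) / 2

lemma triangle_add_one (t : ℤ) : triangle (t + 1) = triangle t + t := by
  unfold triangle
  rw [show (t + 1) * (t + 1 - 1) = t * (t - 1) + t * 2 by ring,
    Int.add_mul_ediv_right _ _ (by norm_num)]

lemma two_mul_triangle (t : ℤ) : 2 * triangle t = t * (t - 1) := by
  unfold triangle
  exact Int.mul_ediv_cancel' (Int.even_mul_pred_self t).two_dvd

/-- The finite form of Jacobi's triple product identity. -/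
lemma finite_jacobi {x z : ℝ} (h0 : 0 < x) (h1 : x < 1) (hz : z ≠ 0) (N : ℕ) :
    HasSum (fun t : ℤ => (-1) ^ t * x ^ triangle t * z ^ t *
        (invQFac x (N - t) * invQFac x (N + t)))
      (invQFac x (2 * N : ℕ) *
        ∏ i ∈ Finset.range N, ((1 - z * x ^ i) * (1 - x ^ (i + 1) / z))) := by
  have hx := h0.ne'
  induction N with
  | zero =>
    convert hasSum_single (0 : ℤ) ?_ using 1
    · simp [invQFac_zero, triangle]
    · intro t ht
      rcases lt_or_gt_of_ne ht with h | h
      · rw [invQFac_of_neg x (m := ((0 : ℕ) : ℤ) + t) (by simpa using h)]; simp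
      · rw [invQFac_of_neg x (m := ((0 : ℕ) : ℤ) - t) (by simpa using h)]; simp
  | succ N ih =>
    set f : ℤ → ℝ := fun t : ℤ => (-1) ^ t * x ^ triangle t * z ^ t *
        (invQFac x (N - t) * invQFac x (N + t)) with hf
    -- multiplication by the new factors `(1 - z x ^ N) (1 - x ^ (N + 1) / z)`: their product is
    -- `(1 + x ^ (2 N + 1)) - z x ^ N - x ^ (N + 1) / z`, and the powers of `z` shift the index
    have a1 := ih.mul_left (1 + x ^ (2 * N + 1))
    have a2 := ((Equiv.subRight (1 : ℤ)).hasSum_iff.2 ih).mul_left (z * x ^ N)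
    have a3 := ((Equiv.addRight (1 : ℤ)).hasSum_iff.2 ih).mul_left (x ^ (N + 1) / z)
    have b1 := one_sub_pow_pos h0 h1 (2 * N)
    have b2 := one_sub_pow_pos h0 h1 (2 * N + 1)
    have key := ((a1.sub a2).sub a3).mul_left
      ((1 - x ^ (2 * N + 1)) * (1 - x ^ (2 * N + 1 + 1)))⁻¹
    refine HasSum.of_eq_of_eq key (fun t => ?_) ?_
    · rw [eq_inv_mul_iff_mul_eq₀ (mul_pos b1 b2).ne']
      simp only [hf, Function.comp, Equiv.subRight_apply, Equiv.coe_addRight]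
      have r1 := invQFac_sub_one h0 h1 ((N : ℤ) + 1 - t)
      have r2 := invQFac_sub_one h0 h1 ((N : ℤ) + 1 + t)
      have r3 := invQFac_sub_one h0 h1 ((N : ℤ) - t)
      have r4 := invQFac_sub_one h0 h1 ((N : ℤ) + t)
      rw [show (N : ℤ) + 1 - t - 1 = N - t by ring] at r1
      rw [show (N : ℤ) + 1 + t - 1 = N + t by ring] at r2
      have t1 := triangle_add_one (t - 1)
      rw [sub_add_cancel] at t1
      rw [show triangle (t - 1) = triangle t - (t - 1) by rw [t1]; ring, triangle_add_one,
        show (N : ℤ) - (t - 1) = N + 1 - t by ring, show (N : ℤ) + (t - 1) = N + t - 1 by ring,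
        show (N : ℤ) - (t + 1) = N - t - 1 by ring, show (N : ℤ) + (t + 1) = N + 1 + t by ring,
        show ((N + 1 : ℕ) : ℤ) - t = N + 1 - t by push_cast; ring,
        show ((N + 1 : ℕ) : ℤ) + t = N + 1 + t by push_cast; ring, r3, r4, r1, r2]
      have m1 : (-1 : ℝ) ≠ 0 := by norm_num
      simp only [zpow_add₀ hx, zpow_sub₀ hx, zpow_add₀ hz, zpow_sub₀ hz, zpow_add₀ m1,
        zpow_sub₀ m1, zpow_one, zpow_natCast]
      have hp : x ^ t ≠ 0 := zpow_ne_zero t hx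
      have hp2 : z ^ t ≠ 0 := zpow_ne_zero t hz
      generalize invQFac x ((N : ℤ) + 1 - t) = ρ
      generalize invQFac x ((N : ℤ) + 1 + t) = σ
      generalize x ^ triangle t = τ
      generalize x ^ t = p at hp ⊢
      generalize z ^ t = w at hp2 ⊢
      generalize (-1 : ℝ) ^ t = ε
      field_simp
      ring
    · rw [eq_inv_mul_iff_mul_eq₀ (mul_pos b1 b2).ne', Finset.prod_range_succ]
      have r1 := invQFac_sub_one h0 h1 ((2 * N + 1 : ℕ) : ℤ)
      have r2 := invQFac_sub_one h0 h1 ((2 * N + 1 + 1 : ℕ) : ℤ)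
      rw [zpow_natCast] at r1 r2
      rw [show ((2 * N + 1 : ℕ) : ℤ) - 1 = (2 * N : ℕ) by push_cast; ring] at r1
      rw [show ((2 * N + 1 + 1 : ℕ) : ℤ) - 1 = (2 * N + 1 : ℕ) by push_cast; ring] at r2
      rw [r1, r2, show 2 * (N + 1) = 2 * N + 1 + 1 by ring]
      field_simp
      ring

lemma summable_pow_natAbs {x : ℝ} (h0 : 0 < x) (h1 : x < 1) :
    Summable fun t : ℤ => x ^ t.natAbs := by
  have := summable_geometric_of_lt_one h0.le h1
  exact Summable.of_nat_of_neg (by simpa using this) (by simpa using this)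

lemma multipliable_one_sub_pow {x : ℝ} (h0 : 0 < x) (h1 : x < 1) :
    Multipliable fun i : ℕ => 1 - x ^ (i + 1) := by
  have : Summable fun i : ℕ => -x ^ (i + 1) :=
    ((summable_nat_add_iff 1).2 (summable_geometric_of_lt_one h0.le h1)).neg
  simpa [sub_eq_add_neg] using Real.multipliable_one_add_of_summable this

lemma tendsto_qFac {x : ℝ} (h0 : 0 < x) (h1 : x < 1) :
    Tendsto (qFac x) atTop (𝓝 (eulerProd x)) :=
  (multipliable_one_sub_pow h0 h1).hasProd.tendsto_prod_nat

lemma eulerProd_le_qFac {x : ℝ} (h0 : 0 < x) (h1 : x < 1) (n : ℕ) : eulerProd x ≤ qFac x n := by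
  refine (antitone_nat_of_succ_le fun n => ?_).le_of_tendsto (tendsto_qFac h0 h1) n
  rw [qFac_succ]
  exact mul_le_of_le_one_right (qFac_pos h0 h1 n).le (by have := pow_pos h0 (n + 1); linarith)

lemma eulerProd_pos {x : ℝ} (h0 : 0 < x) (h1 : x < 1) : 0 < eulerProd x := by
  refine lt_of_le_of_ne (ge_of_tendsto' (tendsto_qFac h0 h1) fun n => (qFac_pos h0 h1 n).le) ?_
  have hs : Summable fun i : ℕ => ‖-x ^ (i + 1)‖ :=
    ((summable_nat_add_iff 1).2 (summable_geometric_of_lt_one h0.le h1)).neg.norm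
  have := tprod_one_add_ne_zero_of_summable (f := fun i : ℕ => -x ^ (i + 1))
    (fun i => by have := (one_sub_pow_pos h0 h1 i).ne'; simpa [← sub_eq_add_neg] using this) hs
  simp only [← sub_eq_add_neg] at this
  exact this.symm

lemma invQFac_le {x : ℝ} (h0 : 0 < x) (h1 : x < 1) (m : ℤ) : invQFac x m ≤ (eulerProd x)⁻¹ := by
  unfold invQFac
  split_ifs
  · exact inv_nonneg.2 (eulerProd_pos h0 h1).le
  · exact inv_anti₀ (eulerProd_pos h0 h1) (eulerProd_le_qFac h0 h1 _)

lemma tendsto_invQFac {x : ℝ} (h0 : 0 < x) (h1 : x < 1) :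
    Tendsto (invQFac x) atTop (𝓝 (eulerProd x)⁻¹) := by
  have ht : Tendsto Int.toNat atTop atTop :=
    tendsto_atTop.2 fun b => (eventually_ge_atTop (b : ℤ)).mono fun m hm => by omega
  refine (((tendsto_qFac h0 h1).comp ht).inv₀ (eulerProd_pos h0 h1).ne').congr' ?_
  filter_upwards [eventually_ge_atTop 0] with m hm
  simp [invQFac, not_lt.2 hm]

/-- If the terms `α t / ((x; x)_{N - t} (x; x)_{N + t})` sum to `b N` for each `N`, with `α`
summable, then `b N` tends to `(∑ α) / (x; x)_∞ ^ 2`. -/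
lemma tendsto_bailey_beta {x : ℝ} (h0 : 0 < x) (h1 : x < 1) {α : ℤ → ℝ} {b : ℕ → ℝ}
    (hα : Summable fun t => ‖α t‖)
    (h : ∀ s : ℕ, HasSum (fun t : ℤ => α t * (invQFac x (s - t) * invQFac x (s + t))) (b s)) :
    Tendsto b atTop (𝓝 ((∑' t, α t) * ((eulerProd x)⁻¹ * (eulerProd x)⁻¹))) := by
  rw [← tsum_mul_right]
  refine (tendsto_tsum_of_dominated_convergence
    (hα.mul_right ((eulerProd x)⁻¹ * (eulerProd x)⁻¹)) (fun t => ?_)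
    (Eventually.of_forall fun N t => ?_)).congr fun N => (h N).tsum_eq
  · refine Tendsto.const_mul _ (Tendsto.mul ?_ ?_)
    · exact (tendsto_invQFac h0 h1).comp
        (tendsto_atTop_add_const_right _ (-t) tendsto_natCast_atTop_atTop)
    · exact (tendsto_invQFac h0 h1).comp
        (tendsto_atTop_add_const_right _ t tendsto_natCast_atTop_atTop)
  · rw [norm_mul]
    have p1 := invQFac_nonneg h0 h1 ((N : ℤ) - t)
    have p2 := invQFac_nonneg h0 h1 ((N : ℤ) + t)
    refine mul_le_mul_of_nonneg_left ?_ (norm_nonneg _)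
    rw [Real.norm_of_nonneg (mul_nonneg p1 p2)]
    exact mul_le_mul (invQFac_le h0 h1 _) (invQFac_le h0 h1 _) p2 (p1.trans (invQFac_le h0 h1 _))

/-- The sum side `∑ x ^ (j ^ 2) / (x; x)_j` of the first Rogers–Ramanujan identity. -/
noncomputable def rrSum (x : ℝ) : ℝ := ∑' j : ℕ, x ^ (j ^ 2) * invQFac x j

lemma summable_rrSum {x : ℝ} (h0 : 0 < x) (h1 : x < 1) :
    Summable fun j : ℕ => x ^ (j ^ 2) * invQFac x j := by
  refine Summable.of_nonneg_of_le (fun j => mul_nonneg (by positivity) (invQFac_nonneg h0 h1 _))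
    (fun j => ?_) ((summable_geometric_of_lt_one h0.le h1).mul_right (eulerProd x)⁻¹)
  refine mul_le_mul (pow_le_pow_of_le_one h0.le h1.le (Nat.le_self_pow two_ne_zero j))
    (invQFac_le h0 h1 _) (invQFac_nonneg h0 h1 _) (by positivity)

lemma summable_rrTheta {x : ℝ} (h0 : 0 < x) (h1 : x < 1) :
    Summable fun t : ℤ => ‖(-1) ^ t * x ^ (triangle t + 2 * t ^ 2)‖ := by
  refine Summable.of_nonneg_of_le (fun _ => norm_nonneg _) (fun t => ?_)
    (summable_pow_natAbs h0 h1)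
  rw [norm_mul, norm_zpow, norm_neg, norm_one, one_zpow, one_mul,
    Real.norm_of_nonneg (zpow_nonneg h0.le _), ← zpow_natCast]
  refine zpow_le_zpow_right_of_le_one₀ h0 h1.le ?_
  have h2 := two_mul_triangle t
  rw [Int.natCast_natAbs]
  rcases abs_cases t with ⟨h, h'⟩ | ⟨h, h'⟩ <;> rw [h] <;> nlinarith

/-- Bailey's lemma, applied twice to the unit Bailey pair (Jacobi's identity at `z = 1`). -/
lemma finite_rogersRamanujan {x : ℝ} (h0 : 0 < x) (h1 : x < 1) (N : ℕ) :
    HasSum (fun t : ℤ => (-1) ^ t * x ^ (triangle t + 2 * t ^ 2) *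
        (invQFac x (N - t) * invQFac x (N + t)))
      (∑ s ∈ Finset.range (N + 1), x ^ (s ^ 2) * invQFac x (N - s) * invQFac x s) := by
  have hunit : ∀ N : ℕ, HasSum (fun t : ℤ => (-1) ^ t * x ^ triangle t *
      (invQFac x (N - t) * invQFac x (N + t))) (if N = 0 then 1 else 0) := by
    intro N
    refine HasSum.of_eq_of_eq (finite_jacobi h0 h1 one_ne_zero N) (fun t => by simp) ?_
    rcases N with _ | N
    · simp [invQFac_zero]
    · rw [Finset.prod_eq_zero (Finset.mem_range.2 N.succ_pos) (by simp)]; simp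
  have h2 := bailey h0 h1 (bailey h0 h1 hunit)
  refine HasSum.of_eq_of_eq (h2 N) (fun t => ?_) (Finset.sum_congr rfl fun s _ => ?_)
  · rw [zpow_add₀ h0.ne', two_mul, zpow_add₀ h0.ne']; ring
  · rw [Finset.sum_eq_single 0] <;> simp +contextual

/-- The theta series is the limit of the Bailey pair `finite_rogersRamanujan`, whose `β`-sequence
tends to the sum side of the identity. -/
lemma rrTheta_eq_sum_side {x : ℝ} (h0 : 0 < x) (h1 : x < 1) :
    ∑' t : ℤ, (-1) ^ t * x ^ (triangle t + 2 * t ^ 2) = eulerProd x * rrSum x := by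
  have hE := eulerProd_pos h0 h1
  have hl := tendsto_bailey_beta h0 h1 (summable_rrTheta h0 h1) (finite_rogersRamanujan h0 h1)
  have hr : Tendsto (fun N : ℕ => ∑ s ∈ Finset.range (N + 1), x ^ (s ^ 2) * invQFac x (N - s) *
      invQFac x s) atTop (𝓝 (rrSum x * (eulerProd x)⁻¹)) := by
    rw [rrSum, ← tsum_mul_right]
    have := tendsto_tsum_of_dominated_convergence (𝓕 := atTop)
      (f := fun N s : ℕ => x ^ (s ^ 2) * invQFac x s * invQFac x (N - s))
      (g := fun s => x ^ (s ^ 2) * invQFac x s * (eulerProd x)⁻¹)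
      ((summable_rrSum h0 h1).mul_right (eulerProd x)⁻¹) (fun s => ?_)
      (Eventually.of_forall fun N s => ?_)
    · refine this.congr fun N => ?_
      rw [tsum_eq_sum (s := Finset.range (N + 1))]
      · exact Finset.sum_congr rfl fun s _ => by ring
      · intro s hs
        rw [Finset.mem_range] at hs
        rw [invQFac_of_neg x (m := (N : ℤ) - s) (by omega), mul_zero]
    · exact ((tendsto_invQFac h0 h1).comp
        (tendsto_atTop_add_const_right _ (-(s : ℤ)) tendsto_natCast_atTop_atTop)).const_mul _
    · have p1 := invQFac_nonneg h0 h1 s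
      have p2 := invQFac_nonneg h0 h1 ((N : ℤ) - s)
      rw [Real.norm_of_nonneg (by positivity)]
      exact mul_le_mul_of_nonneg_left (invQFac_le h0 h1 _) (by positivity)
  have := tendsto_nhds_unique hl hr
  field_simp at this
  linarith

/-- The theta series as an infinite product: Jacobi's identity with base `x ^ 5` at `z = x ^ 2`. -/
lemma tendsto_rrTheta_product_side {x : ℝ} (h0 : 0 < x) (h1 : x < 1) :
    Tendsto (fun N => qFac (x ^ 5) N *
        ∏ i ∈ Finset.range N, ((1 - x ^ (5 * i + 2)) * (1 - x ^ (5 * i + 3))))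
      atTop (𝓝 (∑' t : ℤ, (-1) ^ t * x ^ (triangle t + 2 * t ^ 2))) := by
  have y0 : 0 < x ^ 5 := by positivity
  have y1 : x ^ 5 < 1 := pow_lt_one₀ h0.le h1 (by norm_num)
  have hE := eulerProd_pos y0 y1
  have hJ : ∀ N : ℕ, HasSum (fun t : ℤ => (-1) ^ t * x ^ (triangle t + 2 * t ^ 2) *
      (invQFac (x ^ 5) (N - t) * invQFac (x ^ 5) (N + t))) (invQFac (x ^ 5) (2 * N : ℕ) *
        ∏ i ∈ Finset.range N, ((1 - x ^ (5 * i + 2)) * (1 - x ^ (5 * i + 3)))) := by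
    intro N
    have hz : x ^ 2 ≠ 0 := by positivity
    refine HasSum.of_eq_of_eq (finite_jacobi y0 y1 hz N) (fun t => ?_) ?_
    · have hexp : x ^ (triangle t + 2 * t ^ 2) = (x ^ 5) ^ triangle t * (x ^ 2) ^ t := by
        rw [← zpow_natCast x 5, ← zpow_natCast x 2, ← zpow_mul, ← zpow_mul, ← zpow_add₀ h0.ne']
        have := two_mul_triangle t
        congr 1
        push_cast
        linarith
      rw [hexp]
      ring
    · congr 1
      refine Finset.prod_congr rfl fun i _ => ?_
      have : x ≠ 0 := h0.ne'
      congr 2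
      · ring
      · field_simp
        ring
  have h := tendsto_bailey_beta y0 y1 (summable_rrTheta h0 h1) hJ
  have hq : Tendsto (fun N => qFac (x ^ 5) N * qFac (x ^ 5) (2 * N)) atTop
      (𝓝 (eulerProd (x ^ 5) * eulerProd (x ^ 5))) :=
    (tendsto_qFac y0 y1).mul ((tendsto_qFac y0 y1).comp
      (tendsto_id.const_mul_atTop' (by norm_num)))
  have := hq.mul h
  refine (this.congr fun N => ?_).trans_eq ?_
  · rw [invQFac_natCast]
    have := (qFac_pos y0 y1 (2 * N)).ne'
    field_simp
  · congr 1
    field_simp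

/-- Grouping the factors of Euler's product by residues modulo `5`. -/
lemma qFac_five_mul (x : ℝ) (N : ℕ) : qFac x (5 * N) =
    (∏ i ∈ Finset.range N, ((1 - x ^ (5 * i + 1)) * (1 - x ^ (5 * i + 4)))) *
      (qFac (x ^ 5) N *
        ∏ i ∈ Finset.range N, ((1 - x ^ (5 * i + 2)) * (1 - x ^ (5 * i + 3)))) := by
  induction N with
  | zero => simp [qFac]
  | succ N ih =>
    rw [show 5 * (N + 1) = 5 * N + 1 + 1 + 1 + 1 + 1 by ring]
    simp only [qFac_succ, Finset.prod_range_succ, ih]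
    rw [← pow_mul]
    ring

lemma rrSum_pos {x : ℝ} (h0 : 0 < x) (h1 : x < 1) : 0 < rrSum x := by
  refine (summable_rrSum h0 h1).tsum_pos
    (fun j => mul_nonneg (by positivity) (invQFac_nonneg h0 h1 _)) 0 ?_
  simp [invQFac_zero]

/-- The first Rogers–Ramanujan identity. -/
theorem rogersRamanujan {x : ℝ} (h0 : 0 < x) (h1 : x < 1) :
    HasProd (fun i : ℕ => ((1 - x ^ (5 * i + 1)) * (1 - x ^ (5 * i + 4)))⁻¹) (rrSum x) := by
  have hg : ∀ k : ℕ, Summable fun i : ℕ => x ^ (5 * i + k) := fun k =>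
    Summable.of_nonneg_of_le (fun _ => by positivity)
      (fun i => pow_le_pow_of_le_one h0.le h1.le (by omega)) (summable_geometric_of_lt_one h0.le h1)
  have hpos : ∀ n : ℕ, 0 < n → 0 < 1 - x ^ n := fun n hn =>
    sub_pos.2 (pow_lt_one₀ h0.le h1 hn.ne')
  have hm : ∀ k : ℕ, Multipliable fun i : ℕ => 1 - x ^ (5 * i + k) := fun k => by
    simpa [sub_eq_add_neg] using Real.multipliable_one_add_of_summable (hg k).neg
  have hE := eulerProd_pos h0 h1
  have hS := rrSum_pos h0 h1
  have hθ := tendsto_rrTheta_product_side h0 h1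
  rw [rrTheta_eq_sum_side h0 h1] at hθ
  have h5 := (tendsto_qFac h0 h1).comp (tendsto_id.const_mul_atTop' (show 0 < 5 by norm_num))
  have hP := ((hm 1).mul (hm 4)).hasProd
  have hlim := hP.tendsto_prod_nat
  have heq := tendsto_nhds_unique (h5.congr fun N => by
    simpa using qFac_five_mul x N) (hlim.mul hθ)
  have hval : (∏' i : ℕ, ((1 - x ^ (5 * i + 1)) * (1 - x ^ (5 * i + 4)))) = (rrSum x)⁻¹ := by
    field_simp
    have : eulerProd x * (((∏' i : ℕ, ((1 - x ^ (5 * i + 1)) * (1 - x ^ (5 * i + 4)))) *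
        rrSum x) - 1) = 0 := by linear_combination -heq
    rcases mul_eq_zero.1 this with h | h
    · exact absurd h hE.ne'
    · linarith
  rw [hval] at hP
  simpa using hP.inv₀ (inv_ne_zero hS.ne')

end SemisimpleLimit

namespace SemisimpleLimit

open Filter Topology

/-! ### Euler products over finitely supported exponent vectors -/

section EulerProducts

variable {ι : Type*}

/-- `Finset.prod_sum`, with the choice functions written as finitely supported exponent vectors. -/
lemma prod_sum_eq_sum_finsupp (S : Finset ι) (t : ι → Finset ℕ) (h : ι → ℕ → ℝ) :
    ∏ i ∈ S, ∑ j ∈ t i, h i j = ∑ e ∈ S.finsupp t, ∏ i ∈ S, h i (e i) := by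
  classical
  rw [Finset.prod_sum, Finset.finsupp, Finset.sum_map]
  refine Finset.sum_congr (by congr!) fun p _ => ?_
  rw [← Finset.prod_attach S]
  refine Finset.prod_congr rfl fun i _ => ?_
  simp [Finsupp.indicator_of_mem i.2]

lemma sum_box_eq_prod_sum {h : ι → ℕ → ℝ} (h0 : ∀ i, h i 0 = 1) (S : Finset ι) (N : ℕ) :
    ∑ e ∈ S.finsupp fun _ => Finset.range (N + 1), e.prod h =
      ∏ i ∈ S, ∑ j ∈ Finset.range (N + 1), h i j := by
  rw [prod_sum_eq_sum_finsupp]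
  refine Finset.sum_congr rfl fun e he => ?_
  exact Finsupp.prod_of_support_subset _ (Finset.mem_finsupp_iff.1 he).1 _ fun i _ => h0 i

/-- The boxes of exponent vectors supported in `S` with entries at most `N` exhaust all vectors. -/
lemma tendsto_box :
    Tendsto (fun p : Finset ι × ℕ => p.1.finsupp fun _ => Finset.range (p.2 + 1))
      atTop atTop := by
  classical
  refine tendsto_atTop_finset_of_monotone (fun p p' hp e he => ?_) fun e => ?_
  · rw [Finset.mem_finsupp_iff] at he ⊢
    refine ⟨he.1.trans hp.1, fun i _ => Finset.mem_range.2 ?_⟩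
    have h2 : p.2 ≤ p'.2 := hp.2
    by_cases hi : i ∈ p.1
    · have := Finset.mem_range.1 (he.2 i hi)
      omega
    · rw [Finsupp.notMem_support_iff.1 fun h => hi (he.1 h)]
      omega
  · refine ⟨(e.support, e.support.sup e), ?_⟩
    rw [Finset.mem_finsupp_iff]
    exact ⟨subset_rfl, fun i hi => Finset.mem_range.2 (Nat.lt_succ_of_le (Finset.le_sup hi))⟩

/-- A finite set of exponent vectors lies in a box, over which the sum of the absolute values is a
finite product, bounded by the exponential of `∑ ‖h i (j + 1)‖`. -/
lemma summable_norm_finsupp_prod {h : ι → ℕ → ℝ} (h0 : ∀ i, h i 0 = 1)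
    (hs : Summable fun p : ι × ℕ => ‖h p.1 (p.2 + 1)‖) :
    Summable fun e : ι →₀ ℕ => ‖e.prod h‖ := by
  classical
  refine summable_of_sum_le (fun _ => norm_nonneg _)
    (c := Real.exp (∑' p : ι × ℕ, ‖h p.1 (p.2 + 1)‖)) fun T => ?_
  obtain ⟨⟨S, N⟩, hSN⟩ := ((tendsto_box (ι := ι)).eventually_ge_atTop T).exists
  have hnorm : ∀ e : ι →₀ ℕ, ‖e.prod h‖ = e.prod fun i j => ‖h i j‖ := fun e => by
    simp [Finsupp.prod]
  simp only [hnorm]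
  calc ∑ e ∈ T, (e.prod fun i j => ‖h i j‖)
      ≤ ∑ e ∈ S.finsupp fun _ => Finset.range (N + 1), e.prod fun i j => ‖h i j‖ :=
        Finset.sum_le_sum_of_subset_of_nonneg hSN fun e _ _ => by rw [← hnorm]; positivity
    _ = ∏ i ∈ S, ∑ j ∈ Finset.range (N + 1), ‖h i j‖ :=
        sum_box_eq_prod_sum (h := fun i j => ‖h i j‖) (fun i => by simp [h0]) S N
    _ ≤ ∏ i ∈ S, Real.exp (∑ j ∈ Finset.range N, ‖h i (j + 1)‖) := by
        refine Finset.prod_le_prod (fun i _ => by positivity) fun i _ => ?_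
        rw [Finset.sum_range_succ', h0, norm_one]
        exact Real.add_one_le_exp _
    _ = Real.exp (∑ p ∈ S ×ˢ Finset.range N, ‖h p.1 (p.2 + 1)‖) := by
        rw [← Real.exp_sum, Finset.sum_product]
    _ ≤ _ := Real.exp_le_exp.2 (hs.sum_le_tsum _ fun _ _ => norm_nonneg _)

lemma hasSum_finsupp_prod {h : ι → ℕ → ℝ} (h0 : ∀ i, h i 0 = 1)
    (hs : Summable fun p : ι × ℕ => ‖h p.1 (p.2 + 1)‖) :
    HasSum (fun e : ι →₀ ℕ => e.prod h) (∑' e : ι →₀ ℕ, e.prod h) := by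
  have := Summable.of_norm (f := fun e : ι →₀ ℕ => e.prod h) (summable_norm_finsupp_prod h0 hs)
  exact this.hasSum

/-- The Euler product of a multiplicative function on exponent vectors. -/
theorem hasProd_tsum_finsupp_prod {h : ι → ℕ → ℝ} (h0 : ∀ i, h i 0 = 1)
    (hs : Summable fun p : ι × ℕ => ‖h p.1 (p.2 + 1)‖) :
    HasProd (fun i => ∑' j, h i j) (∑' e : ι →₀ ℕ, e.prod h) := by
  classical
  have hsum : HasSum (fun e : ι →₀ ℕ => e.prod h) (∑' e : ι →₀ ℕ, e.prod h) :=
    hasSum_finsupp_prod h0 hs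
  have hbox : Tendsto (fun p : Finset ι × ℕ =>
      ∑ e ∈ p.1.finsupp fun _ => Finset.range (p.2 + 1), e.prod h) atTop
      (𝓝 (∑' e : ι →₀ ℕ, e.prod h)) := by
    rw [HasSum, SummationFilter.unconditional_filter] at hsum
    exact hsum.comp tendsto_box
  have hloc : ∀ i, Summable (h i) := fun i => by
    have h1 : Summable fun p : ι × ℕ => h p.1 (p.2 + 1) := hs.of_norm
    have h2 : Summable fun j : ℕ => h i (j + 1) := h1.comp_injective (i := fun j => (i, j))
      fun a b hab => (Prod.ext_iff.1 hab).2
    exact (summable_nat_add_iff 1).1 h2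
  rw [HasProd, SummationFilter.unconditional_filter]
  refine Metric.tendsto_nhds.2 fun ε hε => ?_
  rw [eventually_atTop]
  have hev := Metric.tendsto_nhds.1 hbox (ε / 2) (half_pos hε)
  obtain ⟨⟨S₀, N₀⟩, hN⟩ := eventually_atTop.1 hev
  refine ⟨S₀, fun S hS => lt_of_le_of_lt ?_ (half_lt_self hε)⟩
  have hlim : Tendsto (fun N : ℕ => ∏ i ∈ S, ∑ j ∈ Finset.range (N + 1), h i j) atTop
      (𝓝 (∏ i ∈ S, ∑' j, h i j)) :=
    tendsto_finsetProd _ fun i _ =>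
      (tendsto_add_atTop_iff_nat 1).2 (hloc i).hasSum.tendsto_sum_nat
  refine le_of_tendsto (hlim.dist tendsto_const_nhds) ?_
  filter_upwards [eventually_ge_atTop N₀] with N hN'
  rw [← sum_box_eq_prod_sum h0]
  exact (hN (S, N) ⟨hS, hN'⟩).le

end EulerProducts

/-! ### Mean values of multiplicative functions -/

section MeanValues

variable {ι : Type*} {d : ι → ℕ} {q : ℕ}

lemma finite_level (hq : 2 ≤ q)
    (hcard : ∀ m, Nat.card {e : ι →₀ ℕ // Finsupp.weight d e = m} = q ^ m) (m : ℕ) :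
    Finite {e : ι →₀ ℕ // Finsupp.weight d e = m} :=
  Nat.finite_of_card_ne_zero (by rw [hcard]; positivity)

open Classical in
/-- The finset of exponent vectors `e` with `∑ e i * d i = n` (empty, if there are infinitely many
of them). -/
noncomputable def level (d : ι → ℕ) (n : ℕ) : Finset (ι →₀ ℕ) :=
  if h : {e : ι →₀ ℕ | Finsupp.weight d e = n}.Finite then h.toFinset else ∅

lemma mem_level (hq : 2 ≤ q)
    (hcard : ∀ m, Nat.card {e : ι →₀ ℕ // Finsupp.weight d e = m} = q ^ m) {n : ℕ}
    {e : ι →₀ ℕ} : e ∈ level d n ↔ Finsupp.weight d e = n := by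
  have h : {e : ι →₀ ℕ | Finsupp.weight d e = n}.Finite := finite_level hq hcard n
  simp [level, h]

lemma card_level (hq : 2 ≤ q)
    (hcard : ∀ m, Nat.card {e : ι →₀ ℕ // Finsupp.weight d e = m} = q ^ m) (n : ℕ) :
    (level d n).card = q ^ n := by
  rw [← hcard n, ← Nat.card_eq_finsetCard]
  exact Nat.card_congr (Equiv.subtypeEquivRight fun e => mem_level hq hcard)

lemma inv_pos_lt_one (hq : 2 ≤ q) : 0 < (q : ℝ)⁻¹ ∧ (q : ℝ)⁻¹ < 1 := by
  have : (2 : ℝ) ≤ q := by exact_mod_cast hq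
  exact ⟨by positivity, inv_lt_one_of_one_lt₀ (by linarith)⟩

/-- The zeta function of the exponent vectors,
`∑ (q ^ weight e) ^ (-(r + 1)) = 1 / (1 - q ^ (-r))`. -/
lemma hasSum_pow_weight (hq : 2 ≤ q)
    (hcard : ∀ m, Nat.card {e : ι →₀ ℕ // Finsupp.weight d e = m} = q ^ m) {r : ℕ} (hr : 1 ≤ r) :
    HasSum (fun e : ι →₀ ℕ => ((q : ℝ)⁻¹ ^ (r + 1)) ^ (Finsupp.weight d e))
      (1 - (q : ℝ)⁻¹ ^ r)⁻¹ := by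
  obtain ⟨x0, x1⟩ := inv_pos_lt_one hq
  rw [← (Equiv.sigmaFiberEquiv (Finsupp.weight d : (ι →₀ ℕ) → ℕ)).hasSum_iff]
  have hq0 : (q : ℝ) ≠ 0 := by positivity
  have hfib : ∀ m : ℕ, HasSum (fun e : {e : ι →₀ ℕ // Finsupp.weight d e = m} =>
      ((q : ℝ)⁻¹ ^ (r + 1)) ^ (Finsupp.weight d e.1)) (((q : ℝ)⁻¹ ^ r) ^ m) := fun m => by
    have := finite_level hq hcard m
    have := Fintype.ofFinite {e : ι →₀ ℕ // Finsupp.weight d e = m}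
    refine HasSum.of_eq_of_eq (hasSum_fintype _) (fun _ => rfl) ?_
    rw [Finset.sum_congr rfl (g := fun _ => ((q : ℝ)⁻¹ ^ (r + 1)) ^ m) fun e _ => by rw [e.2],
      Finset.sum_const, Finset.card_univ, ← Nat.card_eq_fintype_card, hcard, nsmul_eq_mul]
    push_cast
    rw [← mul_pow]
    rw [pow_succ', ← mul_assoc, mul_inv_cancel₀ hq0, one_mul]
  have hgeo := hasSum_geometric_of_lt_one (pow_nonneg x0.le r)
    (pow_lt_one₀ x0.le x1 (by omega))
  have hsum : Summable ((fun e : ι →₀ ℕ => ((q : ℝ)⁻¹ ^ (r + 1)) ^ (Finsupp.weight d e)) ∘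
      (Equiv.sigmaFiberEquiv (Finsupp.weight d : (ι →₀ ℕ) → ℕ))) := by
    refine (summable_sigma_of_nonneg fun _ => by simp only [Function.comp]; positivity).2
      ⟨fun m => (hfib m).summable, ?_⟩
    refine hgeo.summable.congr fun m => ?_
    exact ((hfib m).tsum_eq).symm
  have := hsum.hasSum.sigma hfib
  rw [hgeo.unique this]
  exact hsum.hasSum

lemma summable_pow_weight_single (hq : 2 ≤ q)
    (hcard : ∀ m, Nat.card {e : ι →₀ ℕ // Finsupp.weight d e = m} = q ^ m) {r : ℕ} (hr : 1 ≤ r) :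
    Summable fun i : ι => ((q : ℝ)⁻¹ ^ d i) ^ (r + 1) := by
  have := (hasSum_pow_weight hq hcard hr).summable.comp_injective
    (i := fun i : ι => Finsupp.single i 1)
    (Finsupp.single_left_injective one_ne_zero)
  refine this.congr fun i => ?_
  simp [Finsupp.weight_single, ← pow_mul, mul_comm]

lemma pow_weight_eq_prod (d : ι → ℕ) (x : ℝ) (e : ι →₀ ℕ) :
    x ^ Finsupp.weight d e = e.prod fun i j => (x ^ d i) ^ j := by
  rw [Finsupp.weight_apply, Finsupp.sum, ← Finset.prod_pow_eq_pow_sum, Finsupp.prod]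
  refine Finset.prod_congr rfl fun i _ => ?_
  rw [← pow_mul, smul_eq_mul, mul_comm]

/-- The Euler product of the zeta function of the exponent vectors. -/
lemma hasProd_zeta (hq : 2 ≤ q) (hd : ∀ i, 1 ≤ d i)
    (hcard : ∀ m, Nat.card {e : ι →₀ ℕ // Finsupp.weight d e = m} = q ^ m) {r : ℕ} (hr : 1 ≤ r) :
    HasProd (fun i => (1 - ((q : ℝ)⁻¹ ^ d i) ^ (r + 1))⁻¹) (1 - (q : ℝ)⁻¹ ^ r)⁻¹ := by
  obtain ⟨x0, x1⟩ := inv_pos_lt_one hq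
  set x := (q : ℝ)⁻¹
  have y1 : ∀ i, (x ^ d i) ^ (r + 1) ≤ x := fun i => by
    rw [← pow_mul]
    exact (pow_le_pow_of_le_one x0.le x1.le (Nat.mul_pos (hd i) r.succ_pos)).trans_eq (pow_one x)
  have hs : Summable fun p : ι × ℕ => ‖((x ^ d p.1) ^ (r + 1)) ^ (p.2 + 1)‖ := by
    refine Summable.of_nonneg_of_le (fun _ => norm_nonneg _) (fun p => ?_)
      ((summable_pow_weight_single hq hcard hr).mul_of_nonneg
        (summable_geometric_of_lt_one x0.le x1) (fun _ => by positivity) fun _ => by positivity)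
    rw [Real.norm_of_nonneg (by positivity), pow_succ']
    exact mul_le_mul_of_nonneg_left (pow_le_pow_left₀ (by positivity) (y1 _) _) (by positivity)
  have := hasProd_tsum_finsupp_prod (h := fun i j => ((x ^ d i) ^ (r + 1)) ^ j)
    (fun i => pow_zero _) hs
  rw [← (hasSum_pow_weight hq hcard hr).tsum_eq]
  convert this using 2 with i e
  · rw [tsum_geometric_of_lt_one (by positivity) ((y1 i).trans_lt x1)]
  · funext e
    rw [pow_weight_eq_prod]
    congr! 3 with i j
    ring

/-- Convolution: if each `w i` is the convolution of `h i` with the powers of `x ^ d i`, then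
`e.prod w` is the sum of `g.prod h * x ^ weight (e - g)` over `g ≤ e`. -/
lemma finsupp_prod_convolution (d : ι → ℕ) (x : ℝ) {w h : ι → ℕ → ℝ} (h0 : ∀ i, h i 0 = 1)
    (hw : ∀ i m, w i m = ∑ j ∈ Finset.range (m + 1), h i j * (x ^ d i) ^ (m - j))
    (e : ι →₀ ℕ) :
    e.prod w = ∑ g ∈ e.support.finsupp fun i => Finset.range (e i + 1),
      g.prod h * x ^ Finsupp.weight d (e - g) := by
  classical
  rw [Finsupp.prod]
  simp only [hw]
  rw [prod_sum_eq_sum_finsupp e.support (fun i => Finset.range (e i + 1))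
    fun i j => h i j * (x ^ d i) ^ (e i - j)]
  refine Finset.sum_congr rfl fun g hg => ?_
  rw [Finset.prod_mul_distrib, pow_weight_eq_prod,
    Finsupp.prod_of_support_subset g (Finset.mem_finsupp_iff.1 hg).1 _ fun i _ => h0 i,
    Finsupp.prod_of_support_subset (e - g) Finsupp.support_tsub _ fun i _ => pow_zero _]
  rfl

/-- The box that `finsupp_prod_convolution` sums over is the set of all `g ≤ e`. -/
lemma mem_lower_box {e g : ι →₀ ℕ} :
    g ∈ e.support.finsupp (fun i => Finset.range (e i + 1)) ↔ g ≤ e := by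
  classical
  rw [Finset.mem_finsupp_iff]
  refine ⟨fun h i => ?_, fun h => ⟨Finsupp.support_mono h, fun i _ => ?_⟩⟩
  · by_cases hi : i ∈ e.support
    · exact Nat.lt_succ_iff.1 (Finset.mem_range.1 (h.2 i hi))
    · rw [Finsupp.notMem_support_iff.1 fun h' => hi (h.1 h')]
      exact Nat.zero_le _
  · exact Finset.mem_range.2 (Nat.lt_succ_iff.2 (h i))

/-- As `q ^ m` exponent vectors have weight `m`, convolution with `q⁻¹ ^ weight` turns the sum over
one level into the sum over all levels up to it. -/
lemma sum_level_eq_sum_sum_level (hq : 2 ≤ q)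
    (hcard : ∀ m, Nat.card {e : ι →₀ ℕ // Finsupp.weight d e = m} = q ^ m)
    {w h : ι → ℕ → ℝ} (h0 : ∀ i, h i 0 = 1)
    (hw : ∀ i m, w i m = ∑ j ∈ Finset.range (m + 1), h i j * ((q : ℝ)⁻¹ ^ d i) ^ (m - j)) (n : ℕ) :
    ∑ e ∈ level d n, e.prod w = ∑ m ∈ Finset.range (n + 1), ∑ g ∈ level d m, g.prod h := by
  set x := (q : ℝ)⁻¹ with hx
  have hR : ∀ m ∈ Finset.range (n + 1), ∑ g ∈ level d m, g.prod h =
      ∑ p ∈ level d m ×ˢ level d (n - m), p.1.prod h * x ^ Finsupp.weight d p.2 := by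
    intro m _
    rw [Finset.sum_product]
    refine Finset.sum_congr rfl fun g _ => ?_
    rw [Finset.sum_congr rfl (g := fun _ => g.prod h * x ^ (n - m)) fun f hf => by
      rw [(mem_level hq hcard).1 hf], Finset.sum_const, card_level hq hcard, nsmul_eq_mul]
    push_cast
    rw [mul_left_comm, hx, ← mul_pow, mul_inv_cancel₀ (by positivity), one_pow, mul_one]
  rw [Finset.sum_congr rfl hR, Finset.sum_congr rfl fun e _ =>
    finsupp_prod_convolution d x h0 hw e, Finset.sum_sigma', Finset.sum_sigma']
  refine Finset.sum_bij' (fun p _ => ⟨Finsupp.weight d p.2, (p.2, p.1 - p.2)⟩)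
    (fun p _ => ⟨p.2.1 + p.2.2, p.2.1⟩) ?_ ?_ ?_ ?_ ?_
  · rintro ⟨e, g⟩ hp
    simp only [Finset.mem_sigma, mem_level hq hcard, mem_lower_box, Finset.mem_range,
      Finset.mem_product] at hp ⊢
    obtain ⟨f, rfl⟩ := exists_add_of_le hp.2
    have := hp.1
    rw [map_add] at this
    rw [add_tsub_cancel_left]
    exact ⟨by omega, trivial, by omega⟩
  · rintro ⟨m, g, f⟩ hp
    simp only [Finset.mem_sigma, mem_level hq hcard, mem_lower_box, Finset.mem_range,
      Finset.mem_product] at hp ⊢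
    rw [map_add]
    exact ⟨by omega, le_self_add⟩
  · rintro ⟨e, g⟩ hp
    simp only [Finset.mem_sigma, mem_lower_box] at hp
    simp [add_tsub_cancel_of_le hp.2]
  · rintro ⟨m, g, f⟩ hp
    simp only [Finset.mem_sigma, mem_level hq hcard, Finset.mem_product] at hp
    obtain ⟨-, rfl, -⟩ := hp
    simp
  · intro p _
    rfl

lemma hasSum_level (hq : 2 ≤ q)
    (hcard : ∀ m, Nat.card {e : ι →₀ ℕ // Finsupp.weight d e = m} = q ^ m) (h : ι → ℕ → ℝ) (m : ℕ) :
    HasSum (fun e : {e : ι →₀ ℕ // Finsupp.weight d e = m} => e.1.prod h)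
      (∑ g ∈ level d m, g.prod h) := by
  have := finite_level hq hcard m
  have := Fintype.ofFinite {e : ι →₀ ℕ // Finsupp.weight d e = m}
  rw [Finset.sum_subtype (level d m) (p := fun e => Finsupp.weight d e = m)
    fun e => mem_level hq hcard]
  exact hasSum_fintype _

/-- The mean value theorem: if `w` is multiplicative with `w i 0 = 1` and
`h i (j + 1) = w i (j + 1) - q⁻¹ ^ d i * w i j` is absolutely summable, then the sum of `w` over the
exponent vectors of weight `n` converges to the Euler product of the series `∑ j, h i j`. -/
theorem exists_tendsto_sum_level (hq : 2 ≤ q)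
    (hcard : ∀ m, Nat.card {e : ι →₀ ℕ // Finsupp.weight d e = m} = q ^ m)
    {w h : ι → ℕ → ℝ} (w0 : ∀ i, w i 0 = 1) (h0 : ∀ i, h i 0 = 1)
    (hw : ∀ i j, h i (j + 1) = w i (j + 1) - (q : ℝ)⁻¹ ^ d i * w i j)
    (hs : Summable fun p : ι × ℕ => ‖h p.1 (p.2 + 1)‖) :
    ∃ L : ℝ, Tendsto (fun n => ∑ e ∈ level d n, e.prod w) atTop (𝓝 L) ∧
      HasProd (fun i => ∑' j, h i j) L := by
  refine ⟨_, ?_, hasProd_tsum_finsupp_prod h0 hs⟩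
  have hconv : ∀ i m, w i m =
      ∑ j ∈ Finset.range (m + 1), h i j * ((q : ℝ)⁻¹ ^ d i) ^ (m - j) := by
    intro i m
    induction m with
    | zero => simp [w0, h0]
    | succ m ih =>
      rw [Finset.sum_range_succ, Nat.sub_self, pow_zero, mul_one, hw, ih, Finset.mul_sum]
      rw [Finset.sum_congr rfl (g := fun j => (q : ℝ)⁻¹ ^ d i *
        (h i j * ((q : ℝ)⁻¹ ^ d i) ^ (m - j))) fun j hj => ?_]
      · ring
      · rw [Finset.mem_range] at hj
        rw [show m + 1 - j = m - j + 1 by omega, pow_succ]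
        ring
  simp only [sum_level_eq_sum_sum_level hq hcard h0 hconv]
  have hfib := hasSum_level hq hcard h
  have hsum : HasSum (fun e : ι →₀ ℕ => e.prod h) (∑' e : ι →₀ ℕ, e.prod h) :=
    hasSum_finsupp_prod h0 hs
  have hsig : HasSum (fun p : Σ m, {e : ι →₀ ℕ // Finsupp.weight d e = m} => p.2.1.prod h)
      (∑' e : ι →₀ ℕ, e.prod h) :=
    (Equiv.hasSum_iff (f := fun e : ι →₀ ℕ => e.prod h)
      (Equiv.sigmaFiberEquiv (Finsupp.weight d : (ι →₀ ℕ) → ℕ))).2 hsum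
  exact (tendsto_add_atTop_iff_nat 1).2 (hsig.sigma hfib).tendsto_sum_nat

end MeanValues

end SemisimpleLimit

namespace SemisimpleLimit

open Filter Topology

/-! ### The local factors -/

/-- The reciprocal of the order of `GL (j, Q)`, as a function of `y = 1 / Q`. -/
noncomputable def invCardGL (y : ℝ) (j : ℕ) : ℝ := y ^ (j ^ 2) * invQFac y j

/-- The coefficients of `(1 - y u) ∑ w j u ^ j` for a sequence with `w 0 = 1`. -/
def localCoeff (y : ℝ) (w : ℕ → ℝ) : ℕ → ℝ
  | 0 => 1
  | j + 1 => w (j + 1) - y * w j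

lemma invCardGL_zero (y : ℝ) : invCardGL y 0 = 1 := by simp [invCardGL, invQFac_zero]

lemma invCardGL_nonneg {y : ℝ} (h0 : 0 < y) (h1 : y < 1) (j : ℕ) : 0 ≤ invCardGL y j :=
  mul_nonneg (by positivity) (invQFac_nonneg h0 h1 _)

lemma invCardGL_le {y : ℝ} (h0 : 0 < y) (h1 : y ≤ 1 / 2) (j : ℕ) :
    invCardGL y j ≤ y ^ (j ^ 2) * 2 ^ j := by
  refine mul_le_mul_of_nonneg_left ?_ (by positivity)
  rw [invQFac_natCast, ← inv_inv ((2 : ℝ) ^ j), ← inv_pow]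
  refine inv_anti₀ (by positivity) ?_
  have hc : ((2 : ℝ)⁻¹) ^ j = ∏ _i ∈ Finset.range j, (2 : ℝ)⁻¹ := by simp
  rw [qFac, hc]
  refine Finset.prod_le_prod (fun _ _ => by positivity) fun i _ => ?_
  have : y ^ (i + 1) ≤ y :=
    (pow_le_pow_of_le_one h0.le (by linarith) (by omega)).trans_eq (pow_one y)
  norm_num
  linarith

lemma invCardGL_add_two_le {y : ℝ} (h0 : 0 < y) (h1 : y ≤ 1 / 2) (j : ℕ) :
    invCardGL y (j + 2) ≤ y ^ 2 * (1 / 2) ^ j := by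
  calc invCardGL y (j + 2) ≤ y ^ ((j + 2) ^ 2) * 2 ^ (j + 2) := invCardGL_le h0 h1 _
    _ ≤ y ^ ((j + 2) + (j + 2)) * 2 ^ (j + 2) := by
        refine mul_le_mul_of_nonneg_right ?_ (by positivity)
        exact pow_le_pow_of_le_one h0.le (by linarith) (by nlinarith)
    _ = y ^ 2 * y ^ j * (2 * y) ^ (j + 2) := by rw [mul_pow]; ring
    _ ≤ y ^ 2 * (1 / 2) ^ j * 1 := by
        have h2 : y ^ j ≤ (1 / 2) ^ j := pow_le_pow_left₀ h0.le h1 j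
        have h3 : (2 * y) ^ (j + 2) ≤ 1 := pow_le_one₀ (by positivity) (by linarith)
        gcongr
    _ = _ := mul_one _

/-- The terms linear in `y` cancel in the coefficients of the local factor. The remaining bound
`O(y ^ 2)` makes the Euler product converge, as `∑ y ^ 2` over the irreducible polynomials is finite
while `∑ y` is not. -/
lemma norm_localCoeff_le {y : ℝ} (h0 : 0 < y) (h1 : y ≤ 1 / 2) (j : ℕ) :
    ‖localCoeff y (invCardGL y) (j + 1)‖ ≤ y ^ 2 * (8 * (1 / 2) ^ j) := by
  have hy1 : y < 1 := by linarith
  have p : ∀ j, 0 ≤ invCardGL y j := invCardGL_nonneg h0 hy1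
  have w1 : invCardGL y 1 = y / (1 - y) := by
    have := invQFac_natCast y 1
    simp only [Nat.cast_one] at this
    simp [invCardGL, this, qFac, div_eq_mul_inv]
  have w1' : invCardGL y 1 ≤ 2 * y := by
    rw [w1, div_le_iff₀ (by linarith)]
    nlinarith
  rcases j with _ | j
  · have : localCoeff y (invCardGL y) (0 + 1) = y ^ 2 / (1 - y) := by
      have : 1 - y ≠ 0 := by linarith
      rw [localCoeff, zero_add, w1, invCardGL_zero]
      field_simp
      ring
    have h2 : 0 < 1 - y := by linarith
    rw [this, Real.norm_of_nonneg (by positivity), div_le_iff₀ h2]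
    nlinarith [sq_nonneg y]
  · have e : localCoeff y (invCardGL y) (j + 1 + 1) =
      invCardGL y (j + 2) - y * invCardGL y (j + 1) := rfl
    have a := invCardGL_add_two_le h0 h1 j
    have b : y * invCardGL y (j + 1) ≤ y ^ 2 * (2 * (1 / 2) ^ j) := by
      rcases j with _ | j
      · nlinarith
      · have := invCardGL_add_two_le h0 h1 j
        have h4 : y * invCardGL y (j + 2) ≤ 1 / 2 * (y ^ 2 * (1 / 2) ^ j) :=
          mul_le_mul h1 this (p _) (by norm_num)
        have h5 : 0 ≤ y ^ 2 * (1 / 2) ^ j := by positivity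
        rw [show j + 1 + 1 = j + 2 by ring, pow_succ (1 / 2 : ℝ) j]
        linarith
    have c : 0 ≤ y * invCardGL y (j + 1) := mul_nonneg h0.le (p _)
    have d : 0 ≤ y ^ 2 * (1 / 2) ^ j := by positivity
    rw [e, Real.norm_eq_abs, abs_le, pow_succ (1 / 2 : ℝ) j]
    constructor <;> nlinarith [p (j + 2)]

lemma tsum_localCoeff {y : ℝ} (h0 : 0 < y) (h1 : y < 1) :
    ∑' j, localCoeff y (invCardGL y) j = (1 - y) * rrSum y := by
  have hw : HasSum (invCardGL y) (rrSum y) := (summable_rrSum h0 h1).hasSum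
  have hw' := (hasSum_nat_add_iff' 1).2 hw
  have : HasSum (fun j => localCoeff y (invCardGL y) (j + 1)) (rrSum y - 1 - y * rrSum y) := by
    refine HasSum.of_eq_of_eq (hw'.sub (hw.mul_left y)) (fun j => rfl) ?_
    simp [invCardGL_zero]
  have h2 := (hasSum_nat_add_iff 1).1 this
  rw [h2.tsum_eq]
  simp [localCoeff]
  ring

lemma norm_inv_mul_sub_one_le {u v : ℝ} (hv : 0 ≤ v) (hvu : v ≤ u) (hu : u ≤ 1 / 2) :
    ‖((1 - u) * (1 - v))⁻¹ - 1‖ ≤ 8 * u := by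
  have h1 : 0 < 1 - u := by linarith
  have h2 : 0 < 1 - v := by linarith
  have e : ((1 - u) * (1 - v))⁻¹ - 1 = (u + v - u * v) / ((1 - u) * (1 - v)) := by
    field_simp
    ring
  have h3 : 1 / 4 ≤ (1 - u) * (1 - v) := by nlinarith
  have h4 : 0 ≤ u + v - u * v := by nlinarith
  rw [e, Real.norm_of_nonneg (by positivity), div_le_iff₀ (by positivity)]
  nlinarith

/-- The factors of the double product over `i` and `n` whose two iterated products are compared. -/
noncomputable def rrFactor (y : ℝ) (n : ℕ) : ℝ :=
  ((1 - y ^ (5 * n + 4)) * (1 - y ^ (5 * n + 6)))⁻¹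

lemma norm_rrFactor_sub_one_le {y : ℝ} (h0 : 0 < y) (h1 : y ≤ 1 / 2) (n : ℕ) :
    ‖rrFactor y n - 1‖ ≤ y ^ 2 * (8 * (1 / 2) ^ n) := by
  have hy1 : y ≤ 1 := by linarith
  have e : y ^ (5 * n + 4) ≤ y ^ 2 * (1 / 2) ^ n := by
    calc y ^ (5 * n + 4) ≤ y ^ (2 + n) := pow_le_pow_of_le_one h0.le hy1 (by omega)
      _ = y ^ 2 * y ^ n := pow_add _ _ _
      _ ≤ _ := mul_le_mul_of_nonneg_left (pow_le_pow_left₀ h0.le h1 n) (by positivity)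
  refine (norm_inv_mul_sub_one_le (by positivity)
    (pow_le_pow_of_le_one h0.le hy1 (by omega)) ?_).trans (by linarith)
  exact (pow_le_pow_of_le_one h0.le hy1 (show 1 ≤ 5 * n + 4 by omega)).trans (by simpa using h1)

/-- The local factor as a product. In the Rogers–Ramanujan product, `1 - y` cancels the first
factor, and the factors `1 - y ^ (5 n + 1)` are shifted by one place to become `1 - y ^ (5 n + 6)`,
so that all exponents are at least `4` and the product over the irreducible polynomials
converges. -/
lemma hasProd_rrFactor {y : ℝ} (h0 : 0 < y) (h1 : y ≤ 1 / 2) :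
    HasProd (rrFactor y) ((1 - y) * rrSum y) := by
  have hy1 : y < 1 := by linarith
  have hs : Summable fun n => rrFactor y n - 1 :=
    Summable.of_norm_bounded ((summable_geometric_two.mul_left 8).mul_left (y ^ 2))
      (norm_rrFactor_sub_one_le h0 h1)
  have hm : Multipliable (rrFactor y) := by
    simpa using Real.multipliable_one_add_of_summable hs
  have hpos : ∀ n : ℕ, 1 - y ^ (n + 1) ≠ 0 := fun n => (one_sub_pow_pos h0 hy1 n).ne'
  have hpart : ∀ N : ℕ, ∏ n ∈ Finset.range N, rrFactor y n =
      (1 - y) * (∏ n ∈ Finset.range N, ((1 - y ^ (5 * n + 1)) * (1 - y ^ (5 * n + 4)))⁻¹) *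
        (1 - y ^ (5 * N + 1))⁻¹ := by
    intro N
    induction N with
    | zero =>
      have := hpos 0
      simp only [zero_add, pow_one] at this
      simp [this]
    | succ N ih =>
      rw [Finset.prod_range_succ, Finset.prod_range_succ, ih, rrFactor,
        show 5 * (N + 1) + 1 = 5 * N + 6 by ring]
      have a := hpos (5 * N)
      have b := hpos (5 * N + 3)
      have c := hpos (5 * N + 5)
      simp only [mul_inv]
      ring
  have hlim : Tendsto (fun N : ℕ => y ^ (5 * N + 1)) atTop (𝓝 0) :=
    (tendsto_pow_atTop_nhds_zero_of_lt_one h0.le hy1).comp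
      (tendsto_atTop_mono (fun n => by simp only [id]; omega) tendsto_id)
  have hlim' : Tendsto (fun N : ℕ => (1 - y ^ (5 * N + 1))⁻¹) atTop (𝓝 1) := by
    simpa using (hlim.const_sub 1).inv₀ (by norm_num)
  have hR := (((rogersRamanujan h0 hy1).tendsto_prod_nat).const_mul (1 - y)).mul hlim'
  rw [mul_one] at hR
  have := tendsto_nhds_unique hm.hasProd.tendsto_prod_nat (hR.congr fun N => (hpart N).symm)
  rw [← this]
  exact hm.hasProd

/-! ### The two mean values and their evaluation -/

section Limits

variable {ι : Type*} {d : ι → ℕ} {q : ℕ}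

lemma inv_pow_le_half (hq : 2 ≤ q) {k : ℕ} (hk : 1 ≤ k) :
    0 < (q : ℝ)⁻¹ ^ k ∧ (q : ℝ)⁻¹ ^ k ≤ 1 / 2 := by
  obtain ⟨x0, x1⟩ := inv_pos_lt_one hq
  have h2 : (2 : ℝ) ≤ q := by exact_mod_cast hq
  refine ⟨pow_pos x0 k, (pow_le_pow_of_le_one x0.le x1.le hk).trans ?_⟩
  rw [pow_one, one_div]
  exact inv_anti₀ (by norm_num) h2

lemma summable_sq_mul_geometric (hq : 2 ≤ q)
    (hcard : ∀ m, Nat.card {e : ι →₀ ℕ // Finsupp.weight d e = m} = q ^ m) :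
    Summable fun p : ι × ℕ => ((q : ℝ)⁻¹ ^ d p.1) ^ 2 * (8 * (1 / 2) ^ p.2) :=
  (summable_pow_weight_single hq hcard le_rfl).mul_of_nonneg
    (summable_geometric_two.mul_left 8) (fun _ => by positivity) fun _ => by positivity

/-- Exchanging the two products of an absolutely convergent double product. -/
lemma hasProd_exchange {κ : Type*} {f : ι × κ → ℝ} (hs : Summable fun p => f p - 1)
    {g : ι → ℝ} {k : κ → ℝ} (hg : ∀ i, HasProd (fun n => f (i, n)) (g i))
    (hk : ∀ n, HasProd (fun i => f (i, n)) (k n)) {A : ℝ} (hA : HasProd g A) : HasProd k A := by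
  have hm : Multipliable f := by simpa using Real.multipliable_one_add_of_summable hs
  obtain ⟨B, hB⟩ := hm
  rw [hA.unique (hB.prod_fiberwise hg)]
  have hsw : HasProd (f ∘ Equiv.prodComm κ ι) B := (Equiv.prodComm κ ι).hasProd_iff.2 hB
  exact hsw.prod_fiberwise hk

/-- The product over `i` of the Rogers–Ramanujan local factors, computed by exchanging the two
products and evaluating the zeta function. -/
lemma hasProd_of_hasProd_local (hq : 2 ≤ q) (hd : ∀ i, 1 ≤ d i)
    (hcard : ∀ m, Nat.card {e : ι →₀ ℕ // Finsupp.weight d e = m} = q ^ m) {L : ℝ}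
    (hL : HasProd (fun i => (1 - (q : ℝ)⁻¹ ^ d i) * rrSum ((q : ℝ)⁻¹ ^ d i)) L) :
    HasProd (fun n : ℕ => ((1 - (q : ℝ)⁻¹ ^ (5 * n + 3)) * (1 - (q : ℝ)⁻¹ ^ (5 * n + 5)))⁻¹) L := by
  have hy := fun i => inv_pow_le_half hq (hd i)
  have hs : Summable fun p : ι × ℕ => rrFactor ((q : ℝ)⁻¹ ^ d p.1) p.2 - 1 :=
    Summable.of_norm_bounded (summable_sq_mul_geometric hq hcard) fun p =>
      norm_rrFactor_sub_one_le (hy p.1).1 (hy p.1).2 p.2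
  have hk : ∀ n : ℕ, HasProd (fun i => rrFactor ((q : ℝ)⁻¹ ^ d i) n)
      ((1 - (q : ℝ)⁻¹ ^ (5 * n + 3)) * (1 - (q : ℝ)⁻¹ ^ (5 * n + 5)))⁻¹ := fun n => by
    have a := hasProd_zeta hq hd hcard (show 1 ≤ 5 * n + 3 by omega)
    have b := hasProd_zeta hq hd hcard (show 1 ≤ 5 * n + 5 by omega)
    simpa only [rrFactor, mul_inv, add_assoc, Nat.reduceAdd] using a.mul b
  have hg : ∀ i, HasProd (fun n => rrFactor ((q : ℝ)⁻¹ ^ d i) n)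
      ((1 - (q : ℝ)⁻¹ ^ d i) * rrSum ((q : ℝ)⁻¹ ^ d i)) := fun i =>
    hasProd_rrFactor (hy i).1 (hy i).2
  exact hasProd_exchange (f := fun p : ι × ℕ => rrFactor ((q : ℝ)⁻¹ ^ d p.1) p.2) hs hg hk hL

/-- The mean value of the reciprocal centralizer orders, over all exponent vectors. -/
theorem exists_tendsto_sum_invCardGL (hq : 2 ≤ q) (hd : ∀ i, 1 ≤ d i)
    (hcard : ∀ m, Nat.card {e : ι →₀ ℕ // Finsupp.weight d e = m} = q ^ m) :
    ∃ L : ℝ, Tendsto (fun n => ∑ e ∈ level d n, e.prod fun i => invCardGL ((q : ℝ)⁻¹ ^ d i))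
        atTop (𝓝 L) ∧
      HasProd (fun i => (1 - (q : ℝ)⁻¹ ^ d i) * rrSum ((q : ℝ)⁻¹ ^ d i)) L := by
  have hy := fun i => inv_pow_le_half hq (hd i)
  obtain ⟨L, hL, hP⟩ := exists_tendsto_sum_level hq hcard
    (w := fun i => invCardGL ((q : ℝ)⁻¹ ^ d i))
    (h := fun i => localCoeff ((q : ℝ)⁻¹ ^ d i) (invCardGL ((q : ℝ)⁻¹ ^ d i)))
    (fun i => invCardGL_zero _) (fun i => rfl) (fun i j => rfl)
    (Summable.of_nonneg_of_le (fun _ => norm_nonneg _)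
      (fun p => norm_localCoeff_le (hy p.1).1 (hy p.1).2 p.2)
      (summable_sq_mul_geometric hq hcard))
  refine ⟨L, hL, ?_⟩
  have e : (fun i => ∑' j, localCoeff ((q : ℝ)⁻¹ ^ d i) (invCardGL ((q : ℝ)⁻¹ ^ d i)) j) =
      fun i => (1 - (q : ℝ)⁻¹ ^ d i) * rrSum ((q : ℝ)⁻¹ ^ d i) := funext fun i =>
    tsum_localCoeff (hy i).1 ((hy i).2.trans_lt (by norm_num))
  rwa [e] at hP

open Classical in
/-- The mean value of the reciprocal centralizer orders, over the exponent vectors that vanish at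
an index `i₀` of degree one: the local factor at `i₀` is replaced by `1 - q⁻¹`. -/
theorem exists_tendsto_sum_invCardGL_of_eq_zero (hq : 2 ≤ q) (hd : ∀ i, 1 ≤ d i)
    (hcard : ∀ m, Nat.card {e : ι →₀ ℕ // Finsupp.weight d e = m} = q ^ m) {i₀ : ι}
    (hi₀ : d i₀ = 1) {L : ℝ}
    (hL : HasProd (fun i => (1 - (q : ℝ)⁻¹ ^ d i) * rrSum ((q : ℝ)⁻¹ ^ d i)) L) :
    Tendsto (fun n => ∑ e ∈ (level d n).filter fun e => e i₀ = 0,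
      e.prod fun i => invCardGL ((q : ℝ)⁻¹ ^ d i)) atTop (𝓝 (L * (rrSum (q : ℝ)⁻¹)⁻¹)) := by
  have hy := fun i => inv_pow_le_half hq (hd i)
  obtain ⟨x0, x1⟩ := inv_pos_lt_one hq
  set x := (q : ℝ)⁻¹ with hx
  -- the local sequence at `i₀` that keeps only the vectors vanishing there
  set δ : ℕ → ℝ := fun j => if j = 0 then 1 else 0 with hδ
  set w : ι → ℕ → ℝ := Function.update (fun i => invCardGL (x ^ d i)) i₀ δ with hw
  have hgeo : Summable fun p : ι × ℕ => (x ^ d p.1) ^ 2 * (8 * (1 / 2) ^ p.2) :=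
    summable_sq_mul_geometric hq hcard
  have hs : Summable fun p : ι × ℕ => ‖localCoeff (x ^ d p.1) (w p.1) (p.2 + 1)‖ := by
    -- the coefficient `-x` at `(i₀, 1)` is not `O(x ^ 2)`; being a single term, it does no harm
    refine Summable.of_nonneg_of_le (fun _ => norm_nonneg _) (fun p => ?_)
      (hgeo.add
        (summable_of_ne_finset_zero (s := {(i₀, 0)})
          (f := fun p : ι × ℕ => if p = (i₀, 0) then (1 : ℝ) else 0)
          fun p hp => if_neg (by simpa using hp)))
    obtain ⟨i, j⟩ := p
    have hnn : 0 ≤ (x ^ d i) ^ 2 * (8 * (1 / 2) ^ j) := by positivity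
    by_cases hi : i = i₀
    · subst hi
      rcases j with _ | j
      · simp only [hw, Function.update_self, localCoeff, hδ, hi₀]
        simp [abs_of_pos x0]
        nlinarith
      · simp only [hw, Function.update_self, localCoeff, hδ]
        simp
        positivity
    · simp only [hw, Function.update_of_ne hi]
      refine (norm_localCoeff_le (hy i).1 (hy i).2 j).trans ?_
      simp [hi]
  obtain ⟨L', hL', hP⟩ := exists_tendsto_sum_level hq hcard (w := w)
    (h := fun i => localCoeff (x ^ d i) (w i)) (fun i => by
      by_cases hi : i = i₀
      · subst hi; simp [hw, hδ]
      · simp [hw, hi, invCardGL_zero]) (fun i => rfl) (fun i j => rfl) hs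
  have e : (fun i => ∑' j, localCoeff (x ^ d i) (w i) j) =
      Function.update (fun i => (1 - x ^ d i) * rrSum (x ^ d i)) i₀ (1 - x) := by
    funext i
    by_cases hi : i = i₀
    · -- the series `1 - x u` at `u = 1`
      subst hi
      rw [Function.update_self, tsum_eq_sum (s := Finset.range 2)]
      · simp [Finset.sum_range_succ, localCoeff, hw, hδ, hi₀]
        ring
      · intro j hj
        obtain ⟨k, rfl⟩ : ∃ k, j = k + 2 := ⟨j - 2, by simp at hj; omega⟩
        simp [localCoeff, hw, hδ]
    · rw [Function.update_of_ne hi, hw]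
      simp only [Function.update_of_ne hi]
      exact tsum_localCoeff (hy i).1 ((hy i).2.trans_lt (by norm_num))
  rw [e] at hP
  have hrel := hL.update' i₀ (1 - x) hP
  simp only [hi₀, pow_one] at hrel
  have hS := (rrSum_pos x0 x1).ne'
  have h1x : 1 - x ≠ 0 := by linarith
  have hval : L' = L * (rrSum x)⁻¹ := by
    field_simp
    apply mul_right_cancel₀ h1x
    linarith
  rw [← hval]
  refine hL'.congr fun n => ?_
  rw [Finset.sum_filter]
  refine Finset.sum_congr rfl fun v _ => ?_
  split_ifs with hv
  · refine Finset.prod_congr rfl fun i hi => ?_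
    have : i ≠ i₀ := by rintro rfl; exact (Finsupp.mem_support_iff.1 hi) hv
    simp [hw, this]
  · refine Finset.prod_eq_zero (Finsupp.mem_support_iff.2 hv) ?_
    simp [hw, hδ, hv]

end Limits

end SemisimpleLimit

namespace SemisimpleLimit

open Filter Topology

/-! ### Products over the indices congruent to `0, ±2` modulo `5` -/

lemma mem_goodIndices {r : ℕ} :
    r ∈ goodIndices ↔ 1 ≤ r ∧ (r % 5 = 0 ∨ r % 5 = 2 ∨ r % 5 = 3) := by
  have h : (r : ZMod 5) = ((r % 5 : ℕ) : ZMod 5) := by simp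
  have h5 : r % 5 < 5 := Nat.mod_lt _ (by norm_num)
  rw [goodIndices, Set.mem_ofPred_eq, h]
  generalize r % 5 = k at h5
  refine and_congr_right fun _ => ?_
  interval_cases k <;> decide

/-- The numbers `5 n + 2`, `5 n + 3`, `5 n + 5` enumerate the good indices. -/
def goodIndicesEquiv : ℕ × Fin 3 ≃ goodIndices where
  toFun p := ⟨5 * p.1 + ![2, 3, 5] p.2, by
    rw [mem_goodIndices]
    obtain ⟨n, k⟩ := p
    fin_cases k <;> simp⟩
  invFun r := ((r - 2) / 5, if (r : ℕ) % 5 = 0 then 2 else if (r : ℕ) % 5 = 2 then 0 else 1)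
  left_inv := by
    rintro ⟨n, k⟩
    fin_cases k <;> simp [Nat.add_mod] <;> omega
  right_inv := by
    rintro ⟨r, hr⟩
    rw [mem_goodIndices] at hr
    ext
    rcases hr.2 with h | h | h <;> simp [h] <;> omega

/-- Given convergence, a product over the good indices may be computed by grouping them in
threes. -/
lemma hasProd_goodIndices {f : ℕ → ℝ} (hf : Multipliable fun r : goodIndices => f r) {A : ℝ}
    (hA : Tendsto (fun N : ℕ =>
      ∏ n ∈ Finset.range N, (f (5 * n + 2) * f (5 * n + 3) * f (5 * n + 5))) atTop (𝓝 A)) :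
    HasProd (fun r : goodIndices => f r) A := by
  obtain ⟨B, hB⟩ := hf
  have h1 : HasProd (fun p : ℕ × Fin 3 => f (goodIndicesEquiv p)) B :=
    (Equiv.hasProd_iff (f := fun r : goodIndices => f r) goodIndicesEquiv).2 hB
  have h2 : HasProd (fun n : ℕ => f (5 * n + 2) * f (5 * n + 3) * f (5 * n + 5)) B := by
    refine h1.prod_fiberwise fun n => ?_
    have := hasProd_fintype fun k : Fin 3 => f (goodIndicesEquiv (n, k))
    rw [Fin.prod_univ_three] at this
    exact this
  rwa [tendsto_nhds_unique hA h2.tendsto_prod_nat]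

lemma summable_pow_goodIndices {x : ℝ} (h0 : 0 < x) (h1 : x < 1) :
    Summable fun r : goodIndices => x ^ ((r : ℕ) - 1) := by
  have : Summable fun r : ℕ => x ^ (r - 1) :=
    (summable_nat_add_iff 1).1 (by simpa using summable_geometric_of_lt_one h0.le h1)
  exact this.subtype _

lemma multipliable_mat {x : ℝ} (h0 : 0 < x) (h1 : x < 1) :
    Multipliable fun r : goodIndices => 1 - x ^ ((r : ℕ) - 1) := by
  simpa [sub_eq_add_neg] using
    Real.multipliable_one_add_of_summable (summable_pow_goodIndices h0 h1).neg

lemma multipliable_gl {x : ℝ} (h0 : 0 < x) (h1 : x < 1) :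
    Multipliable fun r : goodIndices => (1 - x ^ ((r : ℕ) - 1)) / (1 - x ^ (r : ℕ)) := by
  have : Summable fun r : goodIndices => (1 - x ^ ((r : ℕ) - 1)) / (1 - x ^ (r : ℕ)) - 1 := by
    refine Summable.of_norm_bounded
      ((summable_pow_goodIndices h0 h1).mul_right (1 - x)⁻¹) fun r => ?_
    obtain ⟨k, hk⟩ : ∃ k, (r : ℕ) = k + 1 := ⟨r - 1, by have := r.2.1; omega⟩
    rw [hk, Nat.add_sub_cancel]
    have h2 := one_sub_pow_pos h0 h1 k
    have h3 : x ^ (k + 1) ≤ x := (pow_le_pow_of_le_one h0.le h1.le (by omega)).trans_eq (pow_one x)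
    have e : (1 - x ^ k) / (1 - x ^ (k + 1)) - 1 = -(x ^ k * (1 - x) / (1 - x ^ (k + 1))) := by
      field_simp
      ring
    have h4 : 0 < 1 - x := by linarith
    rw [e, norm_neg, Real.norm_of_nonneg (by positivity), div_eq_mul_inv]
    refine mul_le_mul ?_ (inv_anti₀ h4 (by linarith)) (by positivity) (by positivity)
    exact mul_le_of_le_one_right (by positivity) (by linarith)
  simpa using Real.multipliable_one_add_of_summable this

/-- Multiplying by Euler's product turns the product over the complementary residues into the
product over the good indices. -/
lemma hasProd_mat {x : ℝ} (h0 : 0 < x) (h1 : x < 1) {L : ℝ}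
    (hL : HasProd (fun n : ℕ => ((1 - x ^ (5 * n + 3)) * (1 - x ^ (5 * n + 5)))⁻¹) L) :
    HasProd (fun r : goodIndices => 1 - x ^ ((r : ℕ) - 1)) (eulerProd x * L) := by
  refine hasProd_goodIndices (f := fun r => 1 - x ^ (r - 1)) (multipliable_mat h0 h1) ?_
  have h5 := (tendsto_qFac h0 h1).comp (tendsto_id.const_mul_atTop' (show 0 < 5 by norm_num))
  refine (h5.mul hL.tendsto_prod_nat).congr fun N => ?_
  simp only [Function.comp, id]
  induction N with
  | zero => simp [qFac]
  | succ N ih =>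
    rw [Finset.prod_range_succ, Finset.prod_range_succ, ← ih,
      show 5 * (N + 1) = 5 * N + 1 + 1 + 1 + 1 + 1 by ring]
    simp only [qFac_succ, Nat.reduceAdd, add_assoc,
      show 5 * N + 2 - 1 = 5 * N + 1 by omega, show 5 * N + 3 - 1 = 5 * N + 2 by omega,
      show 5 * N + 5 - 1 = 5 * N + 4 by omega]
    have a := (one_sub_pow_pos h0 h1 (5 * N + 2)).ne'
    have b := (one_sub_pow_pos h0 h1 (5 * N + 4)).ne'
    field_simp

/-- Dividing by `rrSum x`, expanded by the Rogers–Ramanujan identity, supplies the numerators; the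
factors `1 - x ^ (5 n + 2)` of the product over the good indices cancel. -/
lemma hasProd_gl {x : ℝ} (h0 : 0 < x) (h1 : x < 1) {L : ℝ}
    (hL : HasProd (fun n : ℕ => ((1 - x ^ (5 * n + 3)) * (1 - x ^ (5 * n + 5)))⁻¹) L) :
    HasProd (fun r : goodIndices => (1 - x ^ ((r : ℕ) - 1)) / (1 - x ^ (r : ℕ)))
      (L * (rrSum x)⁻¹) := by
  refine hasProd_goodIndices (f := fun r => (1 - x ^ (r - 1)) / (1 - x ^ r))
    (multipliable_gl h0 h1) ?_
  have hS := ((rogersRamanujan h0 h1).tendsto_prod_nat).inv₀ (rrSum_pos h0 h1).ne'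
  refine (hL.tendsto_prod_nat.mul hS).congr fun N => ?_
  rw [← Finset.prod_inv_distrib, ← Finset.prod_mul_distrib]
  refine Finset.prod_congr rfl fun n _ => ?_
  simp only [show 5 * n + 2 - 1 = 5 * n + 1 by omega, show 5 * n + 3 - 1 = 5 * n + 2 by omega,
      show 5 * n + 5 - 1 = 5 * n + 4 by omega]
  have a := (one_sub_pow_pos h0 h1 (5 * n + 2)).ne'
  have b := (one_sub_pow_pos h0 h1 (5 * n + 4)).ne'
  have c := (one_sub_pow_pos h0 h1 (5 * n + 1)).ne'
  field_simp

end SemisimpleLimit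

namespace SemisimpleLimit

open Polynomial

/-! ### Counting monic polynomials by their factorizations -/

/-- The monic irreducible polynomials over `F`. -/
@[ext]
structure MonicIrr (F : Type*) [Field F] where
  /-- The underlying polynomial. -/
  poly : F[X]
  monic : poly.Monic
  irreducible : Irreducible poly

section Factorization

variable {F : Type*} [Field F]

/-- The degree of a monic irreducible polynomial. -/
noncomputable def MonicIrr.deg (i : MonicIrr F) : ℕ := i.poly.natDegree

lemma MonicIrr.one_le_deg (i : MonicIrr F) : 1 ≤ i.deg := i.irreducible.natDegree_pos

lemma MonicIrr.isCoprime {i j : MonicIrr F} (h : i ≠ j) : IsCoprime i.poly j.poly := by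
  refine (i.irreducible.coprime_iff_not_dvd).2 fun hd => h (MonicIrr.ext ?_)
  exact eq_of_monic_of_associated i.monic j.monic (i.irreducible.associated_of_dvd j.irreducible hd)

lemma weight_eq_sum_toMultiset {ι : Type*} (d : ι → ℕ) (e : ι →₀ ℕ) :
    Finsupp.weight d e = (e.toMultiset.map d).sum := by
  induction e using Finsupp.induction_linear with
  | zero => simp
  | add e f he hf => simp [he, hf]
  | single i n => simp [Finsupp.weight_single, Multiset.map_nsmul, Multiset.sum_nsmul]

/-- Unique factorization: exponent vectors of weight `n` correspond to monic polynomials of degree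
`n`. -/
noncomputable def weightEquivMonic (n : ℕ) :
    {e : MonicIrr F →₀ ℕ // Finsupp.weight MonicIrr.deg e = n} ≃
      {p : F[X] // p.Monic ∧ p.natDegree = n} := by
  classical
  have hdeg : ∀ s : Multiset (MonicIrr F),
      (s.map MonicIrr.poly).prod.natDegree = (s.map MonicIrr.deg).sum := fun s => by
    rw [natDegree_multiset_prod_of_monic, Multiset.map_map]
    · rfl
    · intro f hf
      obtain ⟨i, -, rfl⟩ := Multiset.mem_map.1 hf
      exact i.monic
  have hmonic : ∀ s : Multiset (MonicIrr F), (s.map MonicIrr.poly).prod.Monic := fun s =>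
    monic_multiset_prod_of_monic _ _ fun i _ => i.monic
  have hnf : ∀ s : Multiset (MonicIrr F),
      UniqueFactorizationMonoid.normalizedFactors (s.map MonicIrr.poly).prod =
        s.map MonicIrr.poly := fun s => by
    rw [UniqueFactorizationMonoid.normalizedFactors_prod_eq]
    · rw [Multiset.map_map]
      exact Multiset.map_congr rfl fun i _ => i.monic.normalize_eq_self
    · intro f hf
      obtain ⟨i, -, rfl⟩ := Multiset.mem_map.1 hf
      exact i.irreducible
  refine Equiv.ofBijective (fun e => ⟨(e.1.toMultiset.map MonicIrr.poly).prod, hmonic _, by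
    rw [hdeg, ← weight_eq_sum_toMultiset, e.2]⟩) ⟨fun e f hef => ?_, fun p => ?_⟩
  · have h1 := congrArg UniqueFactorizationMonoid.normalizedFactors (congrArg Subtype.val hef)
    simp only [hnf] at h1
    exact Subtype.ext (Multiset.toFinsupp.symm.injective
      (Multiset.map_injective (fun _ _ => MonicIrr.ext) h1))
  · obtain ⟨p, hp, hn⟩ := p
    let s : Multiset (MonicIrr F) :=
      (UniqueFactorizationMonoid.normalizedFactors p).attach.map fun f =>
        ⟨f.1, by
          have := UniqueFactorizationMonoid.normalize_normalized_factor f.1 f.2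
          rw [← this]
          exact monic_normalize (UniqueFactorizationMonoid.ne_zero_of_mem_normalizedFactors f.2),
          UniqueFactorizationMonoid.irreducible_of_normalized_factor f.1 f.2⟩
    have hs : s.map MonicIrr.poly = UniqueFactorizationMonoid.normalizedFactors p := by
      simp only [s, Multiset.map_map, Function.comp_def]
      exact Multiset.attach_map_val (UniqueFactorizationMonoid.normalizedFactors p)
    have hprod : (s.map MonicIrr.poly).prod = p := by
      rw [hs]
      exact eq_of_monic_of_associated (hs ▸ hmonic s) hp
        (UniqueFactorizationMonoid.prod_normalizedFactors hp.ne_zero)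
    refine ⟨⟨Multiset.toFinsupp s, ?_⟩, Subtype.ext ?_⟩
    · rw [weight_eq_sum_toMultiset, Multiset.toFinsupp_toMultiset, ← hdeg, hprod, hn]
    · simp only [Multiset.toFinsupp_toMultiset]
      exact hprod

/-- There are `q ^ n` monic polynomials of degree `n`. -/
lemma card_weight [Finite F] (n : ℕ) :
    Nat.card {e : MonicIrr F →₀ ℕ // Finsupp.weight MonicIrr.deg e = n} = Nat.card F ^ n := by
  rw [Nat.card_congr ((weightEquivMonic n).trans ((monicEquivDegreeLT n).trans
    (degreeLTEquiv F n).toEquiv)), Nat.card_fun, Nat.card_eq_fintype_card (α := Fin n),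
    Fintype.card_fin]

end Factorization

/-! ### Semisimple matrices are those annihilated by a squarefree polynomial -/

section Criterion

variable {F : Type*} [Field F] {n : ℕ}

/-- The product of the distinct minimal polynomials over `F` of the eigenvalues is squarefree and
annihilates the matrix. -/
lemma exists_squarefree_of_isSemisimpleMatrix {A : Matrix (Fin n) (Fin n) F}
    (hA : IsSemisimpleMatrix A) : ∃ g : F[X], Squarefree g ∧ aeval A g = 0 := by
  classical
  obtain ⟨P, d, hP⟩ := hA
  set B := A.map (algebraMap F (AlgebraicClosure F)) with hB
  have hint : ∀ i, IsIntegral F (d i) := fun i => Algebra.IsIntegral.isIntegral _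
  set g : F[X] := ∏ p ∈ Finset.univ.image fun i => minpoly F (d i), p with hg
  refine ⟨g, ?_, ?_⟩
  · refine Finset.squarefree_prod_of_pairwise_isCoprime (fun p hp p' hp' hne => ?_) fun p hp => ?_
    · obtain ⟨i, -, rfl⟩ := Finset.mem_image.1 hp
      obtain ⟨j, -, rfl⟩ := Finset.mem_image.1 hp'
      exact IsCoprime.isRelPrime (MonicIrr.isCoprime
        (i := ⟨_, minpoly.monic (hint i), minpoly.irreducible (hint i)⟩)
        (j := ⟨_, minpoly.monic (hint j), minpoly.irreducible (hint j)⟩)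
        fun h => hne (congrArg MonicIrr.poly h))
    · obtain ⟨i, -, rfl⟩ := Finset.mem_image.1 hp
      exact (minpoly.irreducible (hint i)).squarefree
  · have hroot : ∀ i, aeval (d i) g = 0 := fun i => by
      rw [hg, map_prod]
      exact Finset.prod_eq_zero (Finset.mem_image_of_mem _ (Finset.mem_univ i)) (minpoly.aeval _ _)
    have hdiag : aeval (Matrix.diagonal d) g = 0 := by
      have h1 : aeval (Matrix.diagonal d) g = Matrix.diagonal (aeval d g) :=
        aeval_algHom_apply (Matrix.diagonalAlgHom F) d g
      rw [h1]
      ext i j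
      simp [Matrix.diagonal_apply, Polynomial.aeval_pi_apply, hroot]
    have hBP : B * P.val = P.val * Matrix.diagonal d := by
      rw [← hP, ← mul_assoc, ← mul_assoc, ← Units.val_mul, mul_inv_cancel, Units.val_one, one_mul]
    have hconj : ∀ f : F[X], aeval B f * P.val = P.val * aeval (Matrix.diagonal d) f := by
      intro f
      induction f using Polynomial.induction_on' with
      | add f h hf hh => rw [map_add, map_add, add_mul, mul_add, hf, hh]
      | monomial k a =>
        rw [aeval_monomial, aeval_monomial, mul_assoc, ← mul_assoc P.val,
          ← Algebra.commutes a P.val, mul_assoc]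
        congr 1
        induction k with
        | zero => simp
        | succ k ih => rw [pow_succ', pow_succ, mul_assoc, ih, ← mul_assoc, hBP, mul_assoc,
            ← pow_succ', ← pow_succ]
    have hBg : aeval B g = 0 := by
      have := hconj g
      rw [hdiag, mul_zero] at this
      exact (Units.mul_left_eq_zero P).1 this
    have hmap : aeval B g = (aeval A g).map (algebraMap F (AlgebraicClosure F)) :=
      aeval_algHom_apply (Algebra.ofId F (AlgebraicClosure F)).mapMatrix A g
    rw [hmap] at hBg
    ext i j
    have := congrFun (congrFun hBg i) j
    simpa using this

/-- Over a perfect field a squarefree polynomial stays squarefree over the algebraic closure, where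
an eigenbasis exists. -/
lemma isSemisimpleMatrix_of_squarefree [PerfectField F] {A : Matrix (Fin n) (Fin n) F} {g : F[X]}
    (hg : Squarefree g) (hA : aeval A g = 0) : IsSemisimpleMatrix A := by
  classical
  set K := AlgebraicClosure F
  set B := A.map (algebraMap F K) with hB
  have hBg : aeval B (g.map (algebraMap F K)) = 0 := by
    have hmap : aeval B g = (aeval A g).map (algebraMap F K) :=
      aeval_algHom_apply (Algebra.ofId F K).mapMatrix A g
    rw [aeval_map_algebraMap, hmap, hA]
    ext i j
    simp
  set f : Module.End K (Fin n → K) := Matrix.toLin' B with hf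
  have hfg : aeval f (g.map (algebraMap F K)) = 0 := by
    have := aeval_algHom_apply (Matrix.toLinAlgEquiv' (R := K) (n := Fin n)).toAlgHom B
      (g.map (algebraMap F K))
    rw [hBg, map_zero] at this
    exact this
  have hsq : Squarefree (g.map (algebraMap F K)) :=
    (PerfectField.separable_iff_squarefree.2 hg).map.squarefree
  have hss : f.IsSemisimple := Module.End.isSemisimple_of_squarefree_aeval_eq_zero hsq hfg
  have hint : DirectSum.IsInternal fun μ : K => f.eigenspace μ :=
    DirectSum.isInternal_submodule_of_iSupIndep_of_iSup_eq_top
      f.eigenspaces_iSupIndep hss.iSup_eigenspace_eq_top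
  set b := hint.collectedBasis fun μ => Module.finBasis K (f.eigenspace μ) with hb
  have hfin := b.linearIndependent.finite
  have := Fintype.ofFinite (Σ μ : K, Fin (Module.finrank K (f.eigenspace μ)))
  have hc : Fintype.card (Σ μ : K, Fin (Module.finrank K (f.eigenspace μ))) = n := by
    rw [← Module.finrank_eq_card_basis b]; simp
  set ε := Fintype.equivFinOfCardEq hc
  set b' := b.reindex ε with hb'
  set d : Fin n → K := fun j => (ε.symm j).1
  have hmem : ∀ j, f (b' j) = d j • b' j := fun j => by
    have := hint.collectedBasis_mem (fun μ => Module.finBasis K (f.eigenspace μ)) (ε.symm j)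
    rw [hb', Module.Basis.reindex_apply]
    exact Module.End.mem_eigenspace_iff.1 this
  set c := Pi.basisFun K (Fin n)
  let P : GL (Fin n) K := ⟨c.toMatrix b', b'.toMatrix c, c.toMatrix_mul_toMatrix_flip b',
    b'.toMatrix_mul_toMatrix_flip c⟩
  refine ⟨P, d, ?_⟩
  have hPd : B * P.val = P.val * Matrix.diagonal d := by
    ext i j
    rw [Matrix.mul_diagonal]
    have := congrFun (hmem j) i
    rw [hf, Matrix.toLin'_apply] at this
    simp only [P, c, Matrix.mul_apply, Module.Basis.toMatrix_apply, Pi.basisFun_repr]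
    rw [Pi.smul_apply, smul_eq_mul, mul_comm] at this
    exact this
  rw [mul_assoc, hPd, ← mul_assoc, ← Units.val_mul, inv_mul_cancel, Units.val_one, one_mul]

end Criterion

end SemisimpleLimit

namespace SemisimpleLimit

open Polynomial

/-! ### Automorphisms of direct products without mutual homomorphisms -/

section PiAut

variable {R κ : Type*} [CommRing R] [DecidableEq κ] {M : κ → Type*}
  [∀ i, AddCommGroup (M i)] [∀ i, Module R (M i)]

lemma apply_single_eq_single (hM : ∀ i j, i ≠ j → ∀ f : M i →ₗ[R] M j, f = 0)
    (T : (∀ i, M i) →ₗ[R] ∀ i, M i) (i : κ) (m : M i) :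
    T (Pi.single i m) = Pi.single i (T (Pi.single i m) i) := by
  funext j
  by_cases hij : i = j
  · subst hij; simp
  · rw [Pi.single_eq_of_ne (Ne.symm hij)]
    exact LinearMap.congr_fun
      (hM i j hij ((LinearMap.proj j).comp (T.comp (LinearMap.single R M i)))) m

lemma apply_apply_eq [Fintype κ] (hM : ∀ i j, i ≠ j → ∀ f : M i →ₗ[R] M j, f = 0)
    (T : (∀ i, M i) →ₗ[R] ∀ i, M i) (v : ∀ i, M i) (i : κ) :
    T v i = T (Pi.single i (v i)) i := by
  conv_lhs => rw [← Finset.univ_sum_single v, map_sum, Finset.sum_apply]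
  refine Finset.sum_eq_single i (fun j _ hj => ?_) (fun h => absurd (Finset.mem_univ i) h)
  rw [apply_single_eq_single hM, Pi.single_eq_of_ne (Ne.symm hj)]

/-- If there are no nonzero homomorphisms between different factors, an automorphism of a finite
product of modules is a family of automorphisms of the factors. -/
def piAutEquiv [Fintype κ] (hM : ∀ i j, i ≠ j → ∀ f : M i →ₗ[R] M j, f = 0) :
    ((∀ i, M i) ≃ₗ[R] ∀ i, M i) ≃ ∀ i, M i ≃ₗ[R] M i where
  toFun T i := LinearEquiv.ofLinearMap
    ((LinearMap.proj i).comp (T.toLinearMap.comp (LinearMap.single R M i)))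
    ((LinearMap.proj i).comp (T.symm.toLinearMap.comp (LinearMap.single R M i)))
    (LinearMap.ext fun m => by
      have := apply_single_eq_single hM T.symm.toLinearMap i m
      simp only [LinearEquiv.coe_coe] at this
      simp [← this])
    (LinearMap.ext fun m => by
      have := apply_single_eq_single hM T.toLinearMap i m
      simp only [LinearEquiv.coe_coe] at this
      simp [← this])
  invFun T := LinearEquiv.piCongrRight T
  left_inv T := by
    ext v i
    exact (apply_apply_eq hM T.toLinearMap v i).symm
  right_inv T := by
    funext i
    ext m
    simp

end PiAut

/-- Over a quotient ring, linearity over the ring and over the quotient agree, so the automorphism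
group of a free module is a general linear group. -/
noncomputable def autEquivGL {R K : Type*} [CommRing R] [CommRing K] [Algebra R K]
    (h : Function.Surjective (algebraMap R K)) (m : ℕ) :
    ((Fin m → K) ≃ₗ[R] (Fin m → K)) ≃ GL (Fin m) K :=
  Equiv.trans
    { toFun := fun T => T.extendScalarsOfSurjective h
      invFun := fun T => T.restrictScalars R
      left_inv := fun _ => rfl
      right_inv := fun _ => rfl }
    ((LinearMap.GeneralLinearGroup.generalLinearEquiv K (Fin m → K)).symm.trans
      Matrix.GeneralLinearGroup.toLin.symm).toEquiv

/-! ### The standard semisimple modules -/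

section Standard

variable {F : Type*} [Field F]

/-- The residue field `F[X] / (φ)` of a monic irreducible polynomial `φ`. -/
abbrev MonicIrr.ResField (i : MonicIrr F) : Type _ := F[X] ⧸ Ideal.span {i.poly}

instance (i : MonicIrr F) : (Ideal.span {i.poly}).IsMaximal :=
  PrincipalIdealRing.isMaximal_of_irreducible i.irreducible

noncomputable instance (i : MonicIrr F) : Field i.ResField := Ideal.Quotient.field _

/-- The standard semisimple `F[X]`-module `∏ (F[X] / (φ)) ^ e φ`, the product being over a finite
set `S` of monic irreducible polynomials. -/
abbrev StdMod (S : Finset (MonicIrr F)) (e : MonicIrr F →₀ ℕ) : Type _ :=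
  (i : S) → Fin (e i) → i.1.ResField

lemma poly_smul_eq_zero (i : MonicIrr F) {m : ℕ} (v : Fin m → i.ResField) : i.poly • v = 0 := by
  funext k
  rw [Pi.smul_apply, Pi.zero_apply, Algebra.smul_def]
  have : algebraMap F[X] i.ResField i.poly = 0 :=
    Ideal.Quotient.eq_zero_iff_mem.2 (Ideal.mem_span_singleton_self _)
  rw [this, zero_mul]

/-- No nonzero vector is killed by two different monic irreducible polynomials. -/
lemma eq_zero_of_poly_smul {i j : MonicIrr F} (hij : i ≠ j) {M : Type*} [AddCommGroup M]
    [Module F[X] M] {v : M} (hi : i.poly • v = 0) (hj : j.poly • v = 0) : v = 0 := by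
  obtain ⟨a, b, hab⟩ := MonicIrr.isCoprime hij
  rw [← one_smul F[X] v, ← hab, add_smul, mul_smul, mul_smul, hi, hj, smul_zero, smul_zero,
    add_zero]

instance (i : MonicIrr F) : Module.Finite F i.ResField :=
  Module.finite_of_finrank_pos (by
    rw [finrank_quotient_span_eq_natDegree]; exact i.one_le_deg)

lemma finrank_resField (i : MonicIrr F) : Module.finrank F i.ResField = i.deg :=
  finrank_quotient_span_eq_natDegree

lemma finrank_stdMod (S : Finset (MonicIrr F)) {e : MonicIrr F →₀ ℕ} (he : e.support ⊆ S) :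
    Module.finrank F (StdMod S e) = Finsupp.weight MonicIrr.deg e := by
  rw [Module.finrank_pi_fintype, Finsupp.weight_apply,
    Finsupp.sum_of_support_subset e he _ (by simp), ← Finset.sum_coe_sort S]
  refine Finset.sum_congr rfl fun i _ => ?_
  rw [Module.finrank_pi_fintype]
  simp [finrank_resField]

lemma card_resField (i : MonicIrr F) : Nat.card i.ResField = Nat.card F ^ i.deg := by
  rw [Module.natCard_eq_pow_finrank (K := F), finrank_resField]

lemma card_stdMod_aut (S : Finset (MonicIrr F)) (e : MonicIrr F →₀ ℕ) :
    Nat.card (StdMod S e ≃ₗ[F[X]] StdMod S e) =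
      ∏ i ∈ S, Nat.card (GL (Fin (e i)) i.ResField) := by
  classical
  have hM : ∀ i j : S, i ≠ j →
      ∀ f : (Fin (e i) → i.1.ResField) →ₗ[F[X]] (Fin (e j) → j.1.ResField), f = 0 := by
    intro i j hij f
    have hij' : i.1 ≠ j.1 := fun h => hij (Subtype.ext h)
    refine LinearMap.ext fun v => eq_zero_of_poly_smul hij' ?_ ?_
    · rw [← map_smul, poly_smul_eq_zero, map_zero]
    · rw [poly_smul_eq_zero]
  rw [Nat.card_congr (piAutEquiv hM), Nat.card_pi, ← Finset.prod_coe_sort S]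
  refine Finset.prod_congr rfl fun i _ => Nat.card_congr (autEquivGL ?_ _)
  exact Ideal.Quotient.mk_surjective

/-- The kernel of `φ` on the standard module is its `φ`-component. -/
lemma card_ker_stdMod {S : Finset (MonicIrr F)} (e : MonicIrr F →₀ ℕ) {i : MonicIrr F}
    (hi : i ∈ S) :
    Nat.card {v : StdMod S e // i.poly • v = 0} = (Nat.card F ^ i.deg) ^ e i := by
  classical
  have hsupp : ∀ v : StdMod S e, i.poly • v = 0 → v = Pi.single ⟨i, hi⟩ (v ⟨i, hi⟩) := by
    intro v hv
    funext j
    by_cases hj : j = ⟨i, hi⟩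
    · subst hj; simp
    · rw [Pi.single_eq_of_ne hj]
      exact eq_zero_of_poly_smul (i := i) (j := j) (fun h => hj (Subtype.ext h.symm))
        (congrFun hv j) (poly_smul_eq_zero _ _)
  have hker : ∀ w : Fin (e i) → i.ResField,
      i.poly • (Pi.single ⟨i, hi⟩ w : StdMod S e) = 0 := fun w => by
    rw [← Pi.single_smul, poly_smul_eq_zero (i := i), Pi.single_zero]
  have E : {v : StdMod S e // i.poly • v = 0} ≃ (Fin (e i) → i.ResField) :=
    { toFun := fun v => v.1 ⟨i, hi⟩
      invFun := fun w => ⟨Pi.single ⟨i, hi⟩ w, hker w⟩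
      left_inv := fun v => Subtype.ext (hsupp v.1 v.2).symm
      right_inv := fun w => Pi.single_eq_same (M := fun j : S => Fin (e j) → j.1.ResField)
        ⟨i, hi⟩ w }
  rw [Nat.card_congr E, Nat.card_fun, card_resField, Nat.card_eq_fintype_card (α := Fin _),
    Fintype.card_fin]

variable [Finite F]

instance (i : MonicIrr F) : Finite i.ResField := Module.finite_of_finite F

lemma one_lt_card_pow_deg (i : MonicIrr F) : 1 < Nat.card F ^ i.deg :=
  Nat.one_lt_pow (by have := i.one_le_deg; omega) Finite.one_lt_card

/-- Standard modules with different exponents are not isomorphic. -/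
lemma eq_of_stdMod_equiv {S : Finset (MonicIrr F)} {e e' : MonicIrr F →₀ ℕ} (he : e.support ⊆ S)
    (he' : e'.support ⊆ S) (T : StdMod S e ≃ₗ[F[X]] StdMod S e') : e = e' := by
  ext i
  by_cases hi : i ∈ S
  · have h1 : Nat.card {v : StdMod S e // i.poly • v = 0} =
        Nat.card {v : StdMod S e' // i.poly • v = 0} :=
      Nat.card_congr (T.toEquiv.subtypeEquiv fun v => by
        simp only [LinearEquiv.coe_toEquiv, ← map_smul, LinearEquiv.map_eq_zero_iff])
    rw [card_ker_stdMod _ hi, card_ker_stdMod _ hi] at h1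
    exact Nat.pow_right_injective (one_lt_card_pow_deg i) h1
  · rw [Finsupp.notMem_support_iff.1 fun h => hi (he h),
      Finsupp.notMem_support_iff.1 fun h => hi (he' h)]

end Standard

/-! ### Matrices of a given semisimple type -/

section Types

variable {F : Type*} [Field F] {n : ℕ}

/-- The matrix `A` acts on `F ^ n` like `X` acts on the standard module with exponents `e`. -/
def HasType (S : Finset (MonicIrr F)) (A : Matrix (Fin n) (Fin n) F) (e : MonicIrr F →₀ ℕ) : Prop :=
  ∃ T : (Fin n → F) ≃ₗ[F] StdMod S e, ∀ v, T (A.mulVec v) = (X : F[X]) • T v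

lemma map_smul_of_map_X_smul {M N : Type*} [AddCommGroup M] [AddCommGroup N] [Module F M]
    [Module F N] [Module F[X] M] [Module F[X] N] [IsScalarTower F F[X] M] [IsScalarTower F F[X] N]
    (f : M →ₗ[F] N) (hf : ∀ v, f ((X : F[X]) • v) = (X : F[X]) • f v) (p : F[X]) (v : M) :
    f (p • v) = p • f v := by
  induction p using Polynomial.induction_on' with
  | add p r hp hr => rw [add_smul, add_smul, map_add, hp, hr]
  | monomial k a =>
    rw [← C_mul_X_pow_eq_monomial, mul_smul, mul_smul, ← algebraMap_eq, algebraMap_smul,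
      algebraMap_smul, map_smul]
    congr 1
    induction k generalizing v with
    | zero => simp
    | succ k ih => rw [pow_succ, mul_smul, mul_smul, ih, hf]

/-- Linear isomorphisms that commute with `X` are isomorphisms of `F[X]`-modules. -/
noncomputable def commutingEquiv (M : Type*) [AddCommGroup M] [Module F M] [Module F[X] M]
    [IsScalarTower F F[X] M] :
    {T : M ≃ₗ[F] M // ∀ v, T ((X : F[X]) • v) = (X : F[X]) • T v} ≃ (M ≃ₗ[F[X]] M) where
  toFun T := { T.1 with map_smul' := map_smul_of_map_X_smul T.1.toLinearMap T.2 }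
  invFun T := ⟨T.restrictScalars F, fun v => T.map_smul X v⟩
  left_inv _ := rfl
  right_inv _ := rfl

/-- The linear isomorphisms that exhibit the type of a matrix form a torsor under the automorphism
group of the standard module. -/
noncomputable def intertwinerEquiv {S : Finset (MonicIrr F)} {A : Matrix (Fin n) (Fin n) F}
    {e : MonicIrr F →₀ ℕ} (T₀ : (Fin n → F) ≃ₗ[F] StdMod S e)
    (h₀ : ∀ v, T₀ (A.mulVec v) = (X : F[X]) • T₀ v) :
    {T : (Fin n → F) ≃ₗ[F] StdMod S e // ∀ v, T (A.mulVec v) = (X : F[X]) • T v} ≃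
      (StdMod S e ≃ₗ[F[X]] StdMod S e) :=
  Equiv.trans
    (β := {U : StdMod S e ≃ₗ[F] StdMod S e // ∀ v, U ((X : F[X]) • v) = (X : F[X]) • U v})
    { toFun := fun T => ⟨T₀.symm.trans T.1, fun v => by
        have := h₀ (T₀.symm v)
        rw [LinearEquiv.apply_symm_apply] at this
        rw [← this, LinearEquiv.trans_apply, LinearEquiv.symm_apply_apply, T.2]
        rfl⟩
      invFun := fun U => ⟨T₀.trans U.1, fun v => by
        rw [LinearEquiv.trans_apply, h₀, U.2]
        rfl⟩
      left_inv := fun T => by ext; simp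
      right_inv := fun U => by ext; simp }
    (commutingEquiv (StdMod S e))

/-- Orbit counting: all `F`-linear isomorphisms from `F ^ n` to the standard module, sorted by the
matrix that they make correspond to `X`. -/
lemma card_hasType_mul (S : Finset (MonicIrr F)) {e : MonicIrr F →₀ ℕ} (he : e.support ⊆ S)
    (hn : Finsupp.weight MonicIrr.deg e = n) :
    Nat.card {A : Matrix (Fin n) (Fin n) F // HasType S A e} *
      ∏ i ∈ S, Nat.card (GL (Fin (e i)) i.ResField) = Nat.card (GL (Fin n) F) := by
  classical
  rw [← card_stdMod_aut, ← Nat.card_prod]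
  have hrank : Module.finrank F (Fin n → F) = Module.finrank F (StdMod S e) := by
    rw [finrank_stdMod S he, hn]; simp
  have T₀ : (Fin n → F) ≃ₗ[F] StdMod S e := LinearEquiv.ofFinrankEq _ _ hrank
  let xMap : StdMod S e →ₗ[F] StdMod S e :=
    { toFun := fun v => (X : F[X]) • v
      map_add' := smul_add _
      map_smul' := fun a v => smul_comm _ _ _ }
  let mat : ((Fin n → F) ≃ₗ[F] StdMod S e) → Matrix (Fin n) (Fin n) F := fun T =>
    LinearMap.toMatrix' (T.symm.toLinearMap.comp (xMap.comp T.toLinearMap))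
  have hmat : ∀ T A, mat T = A ↔ ∀ v, T (A.mulVec v) = (X : F[X]) • T v := by
    intro T A
    constructor
    · rintro rfl v
      rw [← Matrix.toLin'_apply, Matrix.toLin'_toMatrix']
      simp [xMap]
    · intro h
      apply Matrix.toLin'.injective
      rw [Matrix.toLin'_toMatrix']
      refine LinearMap.ext fun v => ?_
      simp only [xMap, LinearMap.comp_apply, LinearEquiv.coe_coe, LinearMap.coe_mk, AddHom.coe_mk,
        Matrix.toLin'_apply, ← h, LinearEquiv.symm_apply_apply]
  let c : ((Fin n → F) ≃ₗ[F] StdMod S e) → {A : Matrix (Fin n) (Fin n) F // HasType S A e} :=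
    fun T => ⟨mat T, T, (hmat T _).1 rfl⟩
  have E1 : ((Fin n → F) ≃ₗ[F] StdMod S e) ≃ GL (Fin n) F :=
    Equiv.trans
      { toFun := fun T => T.trans T₀.symm
        invFun := fun U => U.trans T₀
        left_inv := fun T => by ext; simp
        right_inv := fun U => by ext; simp }
      ((LinearMap.GeneralLinearGroup.generalLinearEquiv F (Fin n → F)).symm.trans
        Matrix.GeneralLinearGroup.toLin.symm).toEquiv
  have E2 : ∀ A : {A : Matrix (Fin n) (Fin n) F // HasType S A e},
      {T // c T = A} ≃ (StdMod S e ≃ₗ[F[X]] StdMod S e) := fun A =>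
    (Equiv.subtypeEquivRight fun T => by rw [← hmat T A.1, Subtype.ext_iff]).trans
      (intertwinerEquiv A.2.choose A.2.choose_spec)
  rw [← Nat.card_congr E1]
  exact Nat.card_congr (((Equiv.sigmaFiberEquiv c).symm.trans (Equiv.sigmaCongrRight E2)).trans
    (Equiv.sigmaEquivProd _ _)).symm

end Types

end SemisimpleLimit

namespace SemisimpleLimit

open Polynomial

/-! ### Counting semisimple matrices -/

section Counting

variable {F : Type*} [Field F] {n : ℕ}

/-- A type makes the `F[X]`-module defined by the matrix isomorphic to the standard module. -/
lemma HasType.exists_equiv {S : Finset (MonicIrr F)} {A : Matrix (Fin n) (Fin n) F}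
    {e : MonicIrr F →₀ ℕ} (h : HasType S A e) :
    Nonempty (Module.AEval' (Matrix.toLin' A) ≃ₗ[F[X]] StdMod S e) := by
  obtain ⟨T, hT⟩ := h
  exact ⟨LinearEquiv.ofAEval (Matrix.toLin' A) T fun v => by
    rw [← hT]; rfl⟩

lemma HasType.of_equiv {S : Finset (MonicIrr F)} {A : Matrix (Fin n) (Fin n) F}
    {e : MonicIrr F →₀ ℕ} (T : Module.AEval' (Matrix.toLin' A) ≃ₗ[F[X]] StdMod S e) :
    HasType S A e :=
  ⟨(Module.AEval'.of (Matrix.toLin' A)).trans (T.restrictScalars F), fun v => by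
    have := Module.AEval'.X_smul_of (Matrix.toLin' A) v
    rw [Matrix.toLin'_apply] at this
    simp only [LinearEquiv.trans_apply, LinearEquiv.restrictScalars_apply]
    rw [← this, map_smul]⟩

lemma aeval_prod_eq_zero_of_hasType {S : Finset (MonicIrr F)} {A : Matrix (Fin n) (Fin n) F}
    {e : MonicIrr F →₀ ℕ} (h : HasType S A e) : aeval A (∏ i ∈ S, i.poly) = 0 := by
  classical
  obtain ⟨T⟩ := h.exists_equiv
  have h1 : aeval (Matrix.toLin' A) (∏ i ∈ S, i.poly) = 0 := by
    refine LinearMap.ext fun v => ?_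
    have h2 : (∏ i ∈ S, i.poly) • T (Module.AEval'.of (Matrix.toLin' A) v) = 0 := by
      funext i
      rw [Pi.smul_apply, ← Finset.prod_erase_mul S _ i.2, mul_smul, poly_smul_eq_zero, smul_zero]
      rfl
    rw [← map_smul, LinearEquiv.map_eq_zero_iff, ← Module.AEval.of_aeval_smul] at h2
    simpa using h2
  have h3 := aeval_algHom_apply (Matrix.toLinAlgEquiv' (R := F) (n := Fin n)).toAlgHom A
    (∏ i ∈ S, i.poly)
  exact (Matrix.toLinAlgEquiv' (R := F) (n := Fin n)).injective
    ((h3.symm.trans h1).trans (map_zero _).symm)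

/-- A matrix with a type is annihilated by the squarefree polynomial `∏ i ∈ S, i.poly`. -/
lemma HasType.isSemisimpleMatrix [PerfectField F] {S : Finset (MonicIrr F)}
    {A : Matrix (Fin n) (Fin n) F} {e : MonicIrr F →₀ ℕ} (h : HasType S A e) :
    IsSemisimpleMatrix A := by
  refine isSemisimpleMatrix_of_squarefree (Finset.squarefree_prod_of_pairwise_isCoprime
    (fun i _ j _ hij => (MonicIrr.isCoprime hij).isRelPrime)
    fun i _ => i.irreducible.squarefree) (aeval_prod_eq_zero_of_hasType h)

/-- A squarefree polynomial of degree at most `n` divides the product of a set of monic irreducible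
polynomials that contains all those of degree at most `n`. -/
lemma dvd_prod_of_squarefree {S : Finset (MonicIrr F)} (hS : ∀ i : MonicIrr F, i.deg ≤ n → i ∈ S)
    {p : F[X]} (hp : Squarefree p) (hn : p.natDegree ≤ n) : p ∣ ∏ i ∈ S, i.poly := by
  classical
  have hp0 : p ≠ 0 := hp.ne_zero
  have hprod : ∏ i ∈ S, i.poly ≠ 0 := Finset.prod_ne_zero_iff.2 fun i _ => i.irreducible.ne_zero
  rw [UniqueFactorizationMonoid.dvd_iff_normalizedFactors_le_normalizedFactors hp0 hprod,
    Multiset.le_iff_subset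
      ((UniqueFactorizationMonoid.squarefree_iff_nodup_normalizedFactors hp0).1 hp)]
  intro f hf
  have hirr := UniqueFactorizationMonoid.irreducible_of_normalized_factor f hf
  have hnorm := UniqueFactorizationMonoid.normalize_normalized_factor f hf
  have hmon : f.Monic := by rw [← hnorm]; exact monic_normalize hirr.ne_zero
  have hdvd := UniqueFactorizationMonoid.dvd_of_mem_normalizedFactors hf
  have hi : (⟨f, hmon, hirr⟩ : MonicIrr F) ∈ S :=
    hS _ ((natDegree_le_of_dvd hdvd hp0).trans hn)
  rw [UniqueFactorizationMonoid.mem_normalizedFactors_iff' hprod]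
  exact ⟨hirr, hnorm, Finset.dvd_prod_of_mem MonicIrr.poly hi⟩

/-- The `φ`-torsion is a finite-dimensional vector space over the residue field of `φ`. -/
lemma exists_torsionBy_equiv (i : MonicIrr F) (M : Type*) [AddCommGroup M] [Module F M]
    [Module F[X] M] [IsScalarTower F F[X] M] [Module.Finite F M] :
    ∃ k : ℕ, Nonempty (Submodule.torsionBy F[X] M i.poly ≃ₗ[F[X]] (Fin k → i.ResField)) := by
  have : Module.Finite F (Submodule.torsionBy F[X] M i.poly) :=
    Module.Finite.of_injective ((Submodule.subtype _).restrictScalars F) Subtype.val_injective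
  have : Module.Finite i.ResField (Submodule.torsionBy F[X] M i.poly) :=
    Module.Finite.of_restrictScalars_finite F _ _
  have : Module.Free i.ResField (Submodule.torsionBy F[X] M i.poly) :=
    Module.Free.of_divisionRing _ _
  have b := (Module.finBasis i.ResField (Submodule.torsionBy F[X] M i.poly)).equivFun
  exact ⟨_, ⟨b.restrictScalars F[X]⟩⟩

/-- Primary decomposition: a matrix annihilated by a squarefree polynomial has a type. -/
lemma exists_hasType {S : Finset (MonicIrr F)} (hS : ∀ i : MonicIrr F, i.deg ≤ n → i ∈ S)
    {A : Matrix (Fin n) (Fin n) F} {g : F[X]} (hg : Squarefree g) (hA : aeval A g = 0) :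
    ∃ e : MonicIrr F →₀ ℕ, e.support ⊆ S ∧ HasType S A e := by
  classical
  have hdeg : (minpoly F A).natDegree ≤ n := by
    refine (natDegree_le_of_dvd (Matrix.minpoly_dvd_charpoly A) A.charpoly_monic.ne_zero).trans ?_
    rw [Matrix.charpoly_natDegree_eq_dim, Fintype.card_fin]
  have hkill : aeval A (∏ i ∈ S, i.poly) = 0 := by
    obtain ⟨r, hr⟩ := dvd_prod_of_squarefree hS
      (hg.squarefree_of_dvd (minpoly.dvd F A hA)) hdeg
    rw [hr, map_mul, minpoly.aeval, zero_mul]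
  set f := Matrix.toLin' A
  have hkill' : aeval f (∏ i ∈ S, i.poly) = 0 := by
    have := aeval_algHom_apply (Matrix.toLinAlgEquiv' (R := F) (n := Fin n)).toAlgHom A
      (∏ i ∈ S, i.poly)
    rw [hkill, map_zero] at this
    exact this
  let M := Module.AEval' f
  have htor : Module.IsTorsionBy F[X] M (∏ i ∈ S, i.poly) := by
    intro m
    obtain ⟨v, rfl⟩ := (Module.AEval'.of f).surjective m
    rw [← Module.AEval.of_aeval_smul, hkill', zero_smul, map_zero]
  have hdec := Submodule.torsionBy_isInternal (M := M) (S := S) (q := MonicIrr.poly)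
    (fun i _ j _ hij => MonicIrr.isCoprime hij) htor
  let E := (LinearEquiv.ofBijective (DirectSum.coeLinearMap fun i : S =>
    Submodule.torsionBy F[X] M i.1.poly) hdec).symm.trans
    (DirectSum.linearEquivFunOnFintype F[X] S fun i => Submodule.torsionBy F[X] M i.1.poly)
  have hcomp := fun i : MonicIrr F => exists_torsionBy_equiv i M
  choose k hk using hcomp
  refine ⟨Finsupp.indicator S fun i _ => k i, Finsupp.support_indicator_subset _ _, ?_⟩
  refine HasType.of_equiv (E.trans (LinearEquiv.piCongrRight fun i => ?_))
  rw [Finsupp.indicator_of_mem i.2]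
  exact (hk i).some

lemma HasType.weight_eq {S : Finset (MonicIrr F)} {A : Matrix (Fin n) (Fin n) F}
    {e : MonicIrr F →₀ ℕ} (h : HasType S A e) (he : e.support ⊆ S) :
    Finsupp.weight MonicIrr.deg e = n := by
  obtain ⟨T, -⟩ := h
  rw [← finrank_stdMod S he, ← T.finrank_eq]
  simp

lemma HasType.eq [Finite F] {S : Finset (MonicIrr F)} {A : Matrix (Fin n) (Fin n) F}
    {e e' : MonicIrr F →₀ ℕ} (h : HasType S A e) (h' : HasType S A e') (he : e.support ⊆ S)
    (he' : e'.support ⊆ S) : e = e' := by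
  obtain ⟨T⟩ := h.exists_equiv
  obtain ⟨T'⟩ := h'.exists_equiv
  exact eq_of_stdMod_equiv he he' (T.symm.trans T')

/-- The monic irreducible polynomial `X`. -/
noncomputable def MonicIrr.X (F : Type*) [Field F] : MonicIrr F :=
  ⟨Polynomial.X, monic_X, irreducible_X⟩

lemma MonicIrr.deg_X : (MonicIrr.X F).deg = 1 := natDegree_X

/-- The kernel of the matrix corresponds to the kernel of `X`, which is the `X`-component of the
standard module. -/
lemma HasType.isUnit_iff [Finite F] {S : Finset (MonicIrr F)} (hX : MonicIrr.X F ∈ S)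
    {A : Matrix (Fin n) (Fin n) F} {e : MonicIrr F →₀ ℕ} (h : HasType S A e) :
    IsUnit A ↔ e (MonicIrr.X F) = 0 := by
  have hcard := card_ker_stdMod e hX
  obtain ⟨T, hT⟩ := h
  have hcong : Nat.card {v : Fin n → F // A.mulVec v = 0} =
      Nat.card {v : StdMod S e // (MonicIrr.X F).poly • v = 0} :=
    Nat.card_congr (T.toEquiv.subtypeEquiv fun v => by
      rw [← LinearEquiv.map_eq_zero_iff T, hT]; rfl)
  have hinj : IsUnit A ↔ Nat.card {v : Fin n → F // A.mulVec v = 0} = 1 := by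
    rw [← Matrix.mulVec_injective_iff_isUnit]
    have h0 : Function.Injective A.mulVec ↔ ∀ v, A.mulVec v = 0 → v = 0 :=
      injective_iff_map_eq_zero A.mulVecLin
    rw [h0, Nat.card_eq_one_iff_unique]
    constructor
    · exact fun h => ⟨⟨fun v w => Subtype.ext ((h _ v.2).trans (h _ w.2).symm)⟩,
        ⟨⟨0, A.mulVec_zero⟩⟩⟩
    · rintro ⟨hs, -⟩ v hv
      exact congrArg Subtype.val (Subsingleton.elim (⟨v, hv⟩ : {v // A.mulVec v = 0})
        ⟨0, A.mulVec_zero⟩)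
  rw [hinj, hcong, hcard]
  have := one_lt_card_pow_deg (MonicIrr.X F)
  refine ⟨fun h => ?_, fun h => by rw [h, pow_zero]⟩
  by_contra h0
  exact (Nat.one_lt_pow h0 this).ne' h

end Counting

end SemisimpleLimit

namespace SemisimpleLimit

open Polynomial Filter Topology

/-! ### The proportions of semisimple matrices -/

section Proportions

lemma card_GL_eq (K : Type*) [Field K] [Finite K] (m : ℕ) :
    (Nat.card (GL (Fin m) K) : ℝ) =
      (Nat.card K : ℝ) ^ (m ^ 2) * qFac (Nat.card K : ℝ)⁻¹ m := by
  have := Fintype.ofFinite K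
  have hQ : (Nat.card K : ℝ) ≠ 0 := by exact_mod_cast Nat.card_pos.ne'
  rw [Matrix.card_GL_field, ← Nat.card_eq_fintype_card, Fin.prod_univ_eq_prod_range
    fun i => Nat.card K ^ m - Nat.card K ^ i, Nat.cast_prod, qFac, ← Finset.prod_range_reflect
      (fun i => 1 - (Nat.card K : ℝ)⁻¹ ^ (i + 1)), pow_two, pow_mul]
  have hc : ((Nat.card K : ℝ) ^ m) ^ m = ∏ _i ∈ Finset.range m, (Nat.card K : ℝ) ^ m := by simp
  rw [hc, ← Finset.prod_mul_distrib]
  refine Finset.prod_congr rfl fun i hi => ?_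
  rw [Finset.mem_range] at hi
  rw [Nat.cast_sub (Nat.pow_le_pow_right Nat.card_pos (by omega))]
  push_cast
  rw [show m - 1 - i + 1 = m - i by omega, mul_sub, mul_one, inv_pow]
  congr 1
  rw [eq_mul_inv_iff_mul_eq₀ (pow_ne_zero _ hQ), ← pow_add]
  congr 1
  omega

lemma inv_card_GL (K : Type*) [Field K] [Finite K] (m : ℕ) :
    (Nat.card (GL (Fin m) K) : ℝ)⁻¹ = invCardGL (Nat.card K : ℝ)⁻¹ m := by
  rw [card_GL_eq, mul_inv, invCardGL, invQFac_natCast, inv_pow]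

variable {F : Type*} [Field F] [Finite F]

lemma finite_deg_le (N : ℕ) : {i : MonicIrr F | i.deg ≤ N}.Finite := by
  classical
  refine Set.Finite.subset (((Finset.range (N + 1)).biUnion fun m =>
    (level MonicIrr.deg m).biUnion Finsupp.support : Finset (MonicIrr F)).finite_toSet)
    fun i (hi : i.deg ≤ N) => ?_
  rw [Finset.mem_coe, Finset.mem_biUnion]
  refine ⟨i.deg, Finset.mem_range.2 (by omega), Finset.mem_biUnion.2 ⟨Finsupp.single i 1, ?_, ?_⟩⟩
  · rw [mem_level (Finite.one_lt_card (α := F)) card_weight, Finsupp.weight_single, one_smul]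
  · simp

/-- The semisimple matrices with a property that depends only on the type, counted type by type. The
types are taken relative to a set of polynomials that contains those of degree at most `n + 1`, so
that it contains `X` also for `n = 0`. -/
lemma card_semisimple_div_card_GL (n : ℕ) (C : Matrix (Fin n) (Fin n) F → Prop)
    (Q : (MonicIrr F →₀ ℕ) → Prop) [DecidablePred Q]
    (hCQ : ∀ (S : Finset (MonicIrr F)), (∀ i : MonicIrr F, i.deg ≤ n + 1 → i ∈ S) →
      ∀ A e, HasType S A e → (C A ↔ Q e)) :
    (Nat.card {A : Matrix (Fin n) (Fin n) F // IsSemisimpleMatrix A ∧ C A} : ℝ) /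
      Nat.card (GL (Fin n) F) = ∑ e ∈ (level MonicIrr.deg n).filter Q,
        e.prod fun i => invCardGL ((Nat.card F : ℝ)⁻¹ ^ i.deg) := by
  classical
  have hq : 2 ≤ Nat.card F := Finite.one_lt_card
  set S := (finite_deg_le (F := F) (n + 1)).toFinset with hS
  have hmem : ∀ i : MonicIrr F, i.deg ≤ n + 1 → i ∈ S := fun i hi => by simpa [hS] using hi
  have hsupp : ∀ e : MonicIrr F →₀ ℕ, Finsupp.weight MonicIrr.deg e = n → e.support ⊆ S := by
    intro e he i hi
    have := Finsupp.le_weight_of_ne_zero' MonicIrr.deg (Finsupp.mem_support_iff.1 hi)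
    exact hmem i (by omega)
  let E : (Σ e : {e // e ∈ (level (MonicIrr.deg (F := F)) n).filter Q},
      {A : Matrix (Fin n) (Fin n) F // HasType S A e.1}) →
      {A : Matrix (Fin n) (Fin n) F // IsSemisimpleMatrix A ∧ C A} := fun p =>
    ⟨p.2.1, p.2.2.isSemisimpleMatrix,
      (hCQ S hmem _ _ p.2.2).2 (Finset.mem_filter.1 p.1.2).2⟩
  have hE : Function.Bijective E := by
    constructor
    · rintro ⟨⟨e, he⟩, ⟨A, hA⟩⟩ ⟨⟨e', he'⟩, ⟨A', hA'⟩⟩ h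
      obtain rfl : A = A' := congrArg Subtype.val h
      rw [Finset.mem_filter, mem_level hq card_weight] at he he'
      obtain rfl := hA.eq hA' (hsupp e he.1) (hsupp e' he'.1)
      rfl
    · rintro ⟨A, hA, hC⟩
      obtain ⟨g, hg, hAg⟩ := exists_squarefree_of_isSemisimpleMatrix hA
      obtain ⟨e, he, hT⟩ := exists_hasType (fun i hi => hmem i (by omega)) hg hAg
      have hw := hT.weight_eq he
      exact ⟨⟨⟨e, Finset.mem_filter.2 ⟨(mem_level hq card_weight).2 hw,
        (hCQ S hmem _ _ hT).1 hC⟩⟩, ⟨A, hT⟩⟩, rfl⟩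
  rw [← Nat.card_congr (Equiv.ofBijective E hE), Nat.card_sigma, Nat.cast_sum, Finset.sum_div,
    Finset.sum_coe_sort ((level (MonicIrr.deg (F := F)) n).filter Q) fun e =>
      (Nat.card {A : Matrix (Fin n) (Fin n) F // HasType S A e} : ℝ) / Nat.card (GL (Fin n) F)]
  refine Finset.sum_congr rfl fun e he => ?_
  rw [Finset.mem_filter, mem_level hq card_weight] at he
  have hs := hsupp e he.1
  have hmul := card_hasType_mul S hs he.1
  have hGL : (Nat.card (GL (Fin n) F) : ℝ) ≠ 0 := by exact_mod_cast Nat.card_pos.ne'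
  rw [Finsupp.prod_of_support_subset e hs _ fun i _ => invCardGL_zero _]
  have hloc : ∀ i : MonicIrr F, invCardGL ((Nat.card F : ℝ)⁻¹ ^ i.deg) (e i) =
      (Nat.card (GL (Fin (e i)) i.ResField) : ℝ)⁻¹ := fun i => by
    rw [inv_card_GL, card_resField, Nat.cast_pow, inv_pow]
  rw [Finset.prod_congr rfl fun i _ => hloc i, Finset.prod_inv_distrib, ← hmul, Nat.cast_mul,
    Nat.cast_prod]
  rw [← hmul, Nat.cast_mul, Nat.cast_prod] at hGL
  have h1 := left_ne_zero_of_mul hGL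
  have h2 := right_ne_zero_of_mul hGL
  field_simp

/-- A semisimple matrix is invertible if and only if `X` does not occur in its type. -/
lemma probGL_eq (n : ℕ) [DecidablePred fun e : MonicIrr F →₀ ℕ => e (MonicIrr.X F) = 0] :
    probGL F n = ∑ e ∈ (level MonicIrr.deg n).filter fun e => e (MonicIrr.X F) = 0,
      e.prod fun i => invCardGL ((Nat.card F : ℝ)⁻¹ ^ i.deg) := by
  rw [← card_semisimple_div_card_GL n IsUnit _ fun S hS A e h =>
    h.isUnit_iff (hS _ (by rw [MonicIrr.deg_X]; omega)), probGL]
  congr 2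
  exact Nat.card_congr
    { toFun := fun g => ⟨g.1.val, g.2, g.1.isUnit⟩
      invFun := fun A => ⟨A.2.2.unit, A.2.1⟩
      left_inv := fun g => Subtype.ext (Units.ext rfl)
      right_inv := fun A => rfl }

/-- The factor `qFac` is the proportion `|GL (n, q)| / |Mat (n, q)|` of the invertible matrices. -/
lemma probMat_eq (n : ℕ) :
    probMat F n = qFac (Nat.card F : ℝ)⁻¹ n * ∑ e ∈ level MonicIrr.deg n,
      e.prod fun i : MonicIrr F => invCardGL ((Nat.card F : ℝ)⁻¹ ^ i.deg) := by
  classical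
  have h := card_semisimple_div_card_GL (F := F) n (fun _ => True) (fun _ => True)
    fun _ _ _ _ _ => Iff.rfl
  simp only [and_true, Finset.filter_true] at h
  rw [← h, probMat, card_GL_eq F n]
  have hQ : (Nat.card F : ℝ) ≠ 0 := by exact_mod_cast Nat.card_pos.ne'
  have hx := inv_pos_lt_one (q := Nat.card F) Finite.one_lt_card
  have hqf := (qFac_pos hx.1 hx.2 n).ne'
  have hM : (Nat.card (Matrix (Fin n) (Fin n) F) : ℝ) = (Nat.card F : ℝ) ^ (n ^ 2) := by
    rw [show Nat.card (Matrix (Fin n) (Fin n) F) = Nat.card (Fin n → Fin n → F) from rfl,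
      Nat.card_fun, Nat.card_fun, Nat.card_eq_fintype_card (α := Fin n), Fintype.card_fin,
      ← pow_mul, pow_two, Nat.cast_pow]
  rw [hM]
  generalize qFac (Nat.card F : ℝ)⁻¹ n = t at hqf
  field_simp

end Proportions

end SemisimpleLimit

theorem mainTheorem9 (F : Type*) [Field F] [Finite F] (q : ℕ) (hq : Nat.card F = q) :
    (Multipliable (fun r : SemisimpleLimit.goodIndices =>
        (1 - 1 / (q : ℝ) ^ ((r : ℕ) - 1)) / (1 - 1 / (q : ℝ) ^ (r : ℕ))) ∧
      Filter.Tendsto (fun n : ℕ => SemisimpleLimit.probGL F n) Filter.atTop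
        (nhds (∏' r : SemisimpleLimit.goodIndices,
          (1 - 1 / (q : ℝ) ^ ((r : ℕ) - 1)) / (1 - 1 / (q : ℝ) ^ (r : ℕ))))) ∧
    (Multipliable (fun r : SemisimpleLimit.goodIndices => 1 - 1 / (q : ℝ) ^ ((r : ℕ) - 1)) ∧
      Filter.Tendsto (fun n : ℕ => SemisimpleLimit.probMat F n) Filter.atTop
        (nhds (∏' r : SemisimpleLimit.goodIndices, (1 - 1 / (q : ℝ) ^ ((r : ℕ) - 1))))) := by
  classical
  subst hq
  have hq : 2 ≤ Nat.card F := Finite.one_lt_card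
  obtain ⟨x0, x1⟩ := SemisimpleLimit.inv_pos_lt_one hq
  obtain ⟨L, hL, hP⟩ := SemisimpleLimit.exists_tendsto_sum_invCardGL hq
    SemisimpleLimit.MonicIrr.one_le_deg (SemisimpleLimit.card_weight (F := F))
  have hL' := SemisimpleLimit.exists_tendsto_sum_invCardGL_of_eq_zero hq
    SemisimpleLimit.MonicIrr.one_le_deg (SemisimpleLimit.card_weight (F := F))
    (i₀ := SemisimpleLimit.MonicIrr.X F) SemisimpleLimit.MonicIrr.deg_X hP
  have hprod := SemisimpleLimit.hasProd_of_hasProd_local hq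
    SemisimpleLimit.MonicIrr.one_le_deg (SemisimpleLimit.card_weight (F := F)) hP
  have hgl := SemisimpleLimit.hasProd_gl x0 x1 hprod
  have hmat := SemisimpleLimit.hasProd_mat x0 x1 hprod
  simp only [one_div, ← inv_pow]
  refine ⟨⟨hgl.multipliable, ?_⟩, hmat.multipliable, ?_⟩
  · rw [hgl.tprod_eq]
    refine hL'.congr fun n => ?_
    rw [SemisimpleLimit.probGL_eq]
  · rw [hmat.tprod_eq]
    refine ((SemisimpleLimit.tendsto_qFac x0 x1).mul hL).congr fun n => ?_
    rw [SemisimpleLimit.probMat_eq]
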